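/- Let $K$ be a field of characteristic zero and $n\ge 0$ an integer. Let $\mathfrak m_0(n)$ be the Lie algebra over $K$ with basis $e_1,\dots,e_n$ and $[e_1,e_i]=e_{i+1}$ for $2\le i\le n-1$, the brackets $[e_i,e_j]$ of all other pairs $i<j$ being zero; put $e_i=0$ for $i>n$. Let $C^q$ be the space of $q$-linear alternating maps $\mathfrak m_0(n)^q\to\mathfrak m_0(n)$, with the Chevalley–Eilenberg differential of the adjoint representation $$(df)(x_1,\dots,x_{q+1})=\sum_{a}(-1)^{a+1}[x_a,f(\dots,\hat x_a,\dots)]+\sum_{a<b}(-1)^{a+b}f([x_a,x_b],\dots,\hat x_a,\dots,\hat x_b,\dots),$$ and let $H^q=H^q(\mathfrak m_0(n),\mathfrak m_0(n))$ be its cohomology. Let $e^1,\dots,e^n$ be the dual basis, with $e^i=0$ on $\mathfrak m_0(n)$ for $i>n$. For $\mu\in\mathbb Z$ let $C^q_{(\mu)}\subset C^q$ be spanned by the maps $e_l\otimes e^{i_1}\wedge\dots\wedge e^{i_q}$ with $i_1+\dots+i_q+\mu=l$, let $H^q_\mu\subset H^q$ be the space of classes of cocycles in $C^q_{(\mu)}$,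 and let $H^q_+=\sum_{s\ge 0}H^q_s$. On the exterior algebra $\Lambda^*(e^2,e^3,\dots)$ let $D_1$ be the derivation (of degree zero) with $D_1e^2=0$ and $D_1e^i=e^{i-1}$ for $i\ge3$, and let $D_{-1}$ be the linear operator, on forms of positive degree, with $$D_{-1}(\xi\wedge e^i)=\sum_{l\ge0}(-1)^lD_1^l(\xi)\wedge e^{i+1+l}\qquad(i\ge2,\ \xi\in\Lambda^*(e^2,\dots,e^{i-1})).$$ Put $\omega(e^j\wedge e^{j+1})=\sum_{l\ge0}(-1)^lD_1^l(e^j)\wedge e^{j+1+l}$ for $j\ge2$ and $\omega(e^i\wedge e^j\wedge e^{j+1})=\sum_{l\ge0}(-1)^lD_1^l(e^i\wedge e^j)\wedge e^{j+1+l}$ for $2\le i<j$ (all these sums are finite). **Theorem.** 1. $H^2_+=\bigoplus_{0\le s\le n-5}H^2_s$ (so $H^2_+=0$ if $n<5$). The cochains $$\Psi_{j,s}=\sum_{k=0}^{n-2j-1-s}e_{2j+1+s+k}\otimes D_{-1}^k\,\omega(e^j\wedge e^{j+1}),\qquad 2\le j,\ s\ge0,\ 2j+1+s\le n,$$ are cocycles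 in $C^2_{(s)}$, and their classes form a basis of $H^2_+$. 2. $H^3_+=\bigoplus_{0\le s\le n-9}H^3_s$ (so $H^3_+=0$ if $n<9$). The cochains $$\Psi_{i,j,s}=\sum_{k=0}^{n-i-2j-1-s}e_{i+2j+1+s+k}\otimes D_{-1}^k\,\omega(e^i\wedge e^j\wedge e^{j+1}),\qquad 2\le i<j,\ s\ge0,\ i+2j+1+s\le n,$$ are cocycles in $C^3_{(s)}$, and their classes form a basis of $H^3_+$. -/

import Mathlib

/-! ## Lie algebra cohomology with coefficients in a module -/

namespace LieCohomology

variable {K L V : Type*} [Field K] [LieRing L] [LieAlgebra K L]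
  [AddCommGroup V] [Module K V]

/-- The sum `∑ (-1) ^ (a + b - 1) • f (⁅x a, x b⁆, x 0, …, omit x a, …, omit x b, …)` over the
pairs `a < b` of positions (numbered from `0`); such a pair is encoded as
`a = i.castSucc`, `b = j.succ` with `i ≤ j`. -/
def bracketSum {q : ℕ} (f : L [⋀^Fin (q + 1)]→ₗ[K] V) (x : Fin (q + 2) → L) : V :=
  ∑ i : Fin (q + 1), ∑ j ≥ i, (-1 : ℤ) ^ (i + j : ℕ) •
    f (Matrix.vecCons ⁅x i.castSucc, x j.succ⁆ (j.removeNth (i.castSucc.removeNth x)))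

/-- Twice `bracketSum f`, obtained by antisymmetrization; it shows that `bracketSum f` is
multilinear and alternating. -/
noncomputable def bracketTwice {q : ℕ} (f : L [⋀^Fin (q + 1)]→ₗ[K] V) :
    L [⋀^Fin (q + 2)]→ₗ[K] V :=
  AlternatingMap.alternatizeUncurryFin (AlternatingMap.alternatizeUncurryFinLM ∘ₗ
    (LinearMap.compr₂ (LieModule.toEnd K L L : L →ₗ[K] L →ₗ[K] L) f.curryLeft))

theorem bracketTwice_apply {q : ℕ} (f : L [⋀^Fin (q + 1)]→ₗ[K] V) (x : Fin (q + 2) → L) :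
    bracketTwice f x = (2 : K) • bracketSum f x := by
  rw [bracketTwice, AlternatingMap.alternatizeUncurryFin_alternatizeUncurryFinLM_comp_apply,
    bracketSum, Finset.smul_sum]
  refine Finset.sum_congr rfl fun i _ => ?_
  rw [Finset.smul_sum]
  refine Finset.sum_congr rfl fun j _ => ?_
  have h (a b : L) (v : Fin q → L) :
      f (Matrix.vecCons ⁅b, a⁆ v) = - f (Matrix.vecCons ⁅a, b⁆ v) := by
    rw [← lie_skew]
    exact DFunLike.congr_fun (f.curryLeft.map_neg ⁅a, b⁆) v
  simp only [LinearMap.compr₂_apply, LieHom.coe_toLinearMap, LieModule.toEnd_apply_apply,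
    AlternatingMap.curryLeft_apply_apply, h (x i.castSucc) (x j.succ), sub_neg_eq_add]
  rw [two_smul, smul_add]

variable [CharZero K]

theorem bracketSum_eq {q : ℕ} (f : L [⋀^Fin (q + 1)]→ₗ[K] V) (x : Fin (q + 2) → L) :
    bracketSum f x = (2 : K)⁻¹ • bracketTwice f x := by
  rw [bracketTwice_apply, inv_smul_smul₀ two_ne_zero]

/-- `bracketSum f` as an alternating map. -/
noncomputable def bracketPart (q : ℕ) :
    (L [⋀^Fin (q + 1)]→ₗ[K] V) →ₗ[K] (L [⋀^Fin (q + 2)]→ₗ[K] V) where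
  toFun f :=
    { toFun := bracketSum f
      map_update_add' := @fun inst m i x y => by
        rw [Subsingleton.elim inst (instDecidableEqFin (q + 2))]
        simp only [bracketSum_eq, AlternatingMap.map_update_add, smul_add]
      map_update_smul' := @fun inst m i c x => by
        rw [Subsingleton.elim inst (instDecidableEqFin (q + 2))]
        simp only [bracketSum_eq, AlternatingMap.map_update_smul, smul_comm c]
      map_eq_zero_of_eq' := fun v i j h hij => by
        rw [bracketSum_eq, AlternatingMap.map_eq_zero_of_eq _ v h hij, smul_zero] }
  map_add' f g := by
    ext v
    simp [bracketSum, Finset.sum_add_distrib]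
  map_smul' c f := by
    ext v
    simp [bracketSum, Finset.smul_sum, smul_comm c]

variable [LieRingModule L V] [LieModule K L V]

/-- The part `∑ i, (-1) ^ i • ⁅x i, f (x 0, …, omit x i, …, x q)⁆` of the differential
(entries are numbered from `0`). -/
noncomputable def actionPart (q : ℕ) :
    (L [⋀^Fin q]→ₗ[K] V) →ₗ[K] (L [⋀^Fin (q + 1)]→ₗ[K] V) where
  toFun f := AlternatingMap.alternatizeUncurryFin
    { toFun := fun x => (LieModule.toEnd K L V x).compAlternatingMap f
      map_add' := fun x y => by ext v; simp
      map_smul' := fun c x => by ext v; simp }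
  map_add' f g := by
    ext v
    simp [AlternatingMap.alternatizeUncurryFin_apply, Finset.sum_add_distrib]
  map_smul' c f := by
    ext v
    simp [AlternatingMap.alternatizeUncurryFin_apply, Finset.smul_sum, smul_comm c]

variable (K L V) in
/-- The Chevalley–Eilenberg differential `C^q(L, V) → C^(q+1)(L, V)`, where `C^q(L, V)` is the
space of `q`-linear alternating maps from `L` to `V`. With the arguments numbered from `1`,
`(d f)(x_1, …, x_{q+1}) = ∑_a (-1)^(a+1) ⁅x_a, f(x_1, …, omit x_a, …, x_{q+1})⁆
  + ∑_{a<b} (-1)^(a+b) f(⁅x_a, x_b⁆, x_1, …, omit x_a, …, omit x_b, …, x_{q+1})`. -/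
noncomputable def d : (q : ℕ) → (L [⋀^Fin q]→ₗ[K] V) →ₗ[K] (L [⋀^Fin (q + 1)]→ₗ[K] V)
  | 0 => actionPart 0
  | q + 1 => actionPart (q + 1) - bracketPart q

variable (K L V) in
/-- The `q`-cocycles. -/
noncomputable def cocycles (q : ℕ) : Submodule K (L [⋀^Fin q]→ₗ[K] V) :=
  LinearMap.ker (d K L V q)

variable (K L V) in
/-- The `q`-coboundaries. -/
noncomputable def coboundaries : (q : ℕ) → Submodule K (L [⋀^Fin q]→ₗ[K] V)
  | 0 => ⊥
  | q + 1 => LinearMap.range (d K L V q)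

variable (K L V) in
/-- The cohomology space `H^q(L, V)`: cocycles modulo coboundaries. -/
abbrev H (q : ℕ) : Type _ :=
  cocycles K L V q ⧸ (coboundaries K L V q).submoduleOf (cocycles K L V q)

variable (K L V) in
/-- The cohomology class of a cocycle. -/
noncomputable def cls (q : ℕ) (f : L [⋀^Fin q]→ₗ[K] V) (hf : f ∈ cocycles K L V q) : H K L V q :=
  Submodule.Quotient.mk ⟨f, hf⟩

end LieCohomology

/-! ## The filiform Lie algebra `𝔪₀(n)` -/

/-- The vector space of `𝔪₀(n)`, with basis `e 1, …, e n`; a vector is its list of coordinates,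
and the entry with number `k : Fin n` is the coefficient of `e (k + 1)`. -/
def M0 (K : Type*) (n : ℕ) : Type _ := Fin n → K

namespace M0

variable {K : Type*} [Field K] {n : ℕ}

instance : AddCommGroup (M0 K n) := inferInstanceAs (AddCommGroup (Fin n → K))

instance : Module K (M0 K n) := inferInstanceAs (Module K (Fin n → K))

variable (K n) in
/-- The basis vector `e i` for `1 ≤ i ≤ n`, and `0` for the other `i`. -/
def e (i : ℕ) : M0 K n := fun k => if (k : ℕ) + 1 = i then 1 else 0

/-- The coefficient of `e (k + 1)`. -/
def entry (k : Fin n) : M0 K n →ₗ[K] K := (LinearMap.proj k : (Fin n → K) →ₗ[K] K)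

variable (K n) in
/-- The linear form `e^i` dual to `e i` for `1 ≤ i ≤ n`, and `0` for the other `i`. -/
def coord (i : ℕ) : M0 K n →ₗ[K] K :=
  if h : 1 ≤ i ∧ i ≤ n then entry ⟨i - 1, by omega⟩ else 0

/-- The bracket with `⁅e 1, e i⁆ = e (i + 1)` for `2 ≤ i ≤ n - 1`, where `⁅e i, e j⁆ = 0` for the
other pairs with `i < j`: the coefficient of `e (k + 1)` in `⁅x, y⁆` is
`x₁ y_k - y₁ x_k` for `k ≥ 2` and `0` for `k ≤ 1`. -/
instance : Bracket (M0 K n) (M0 K n) where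
  bracket x y := fun k : Fin n =>
    if 2 ≤ (k : ℕ) then coord K n 1 x * coord K n k y - coord K n 1 y * coord K n k x else 0

theorem ext_entry {x y : M0 K n} (h : ∀ k, entry k x = entry k y) : x = y := funext h

theorem entry_lie (x y : M0 K n) (k : Fin n) : entry k ⁅x, y⁆ =
    if 2 ≤ (k : ℕ) then coord K n 1 x * coord K n k y - coord K n 1 y * coord K n k x else 0 :=
  rfl

theorem coord_lie (x y : M0 K n) (i : ℕ) : coord K n i ⁅x, y⁆ =
    if 3 ≤ i ∧ i ≤ n then coord K n 1 x * coord K n (i - 1) y - coord K n 1 y * coord K n (i - 1) x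
    else 0 := by
  by_cases h : 1 ≤ i ∧ i ≤ n
  · rw [coord, dif_pos h, entry_lie]
    exact if_congr (by simp only; omega) rfl rfl
  · rw [coord, dif_neg h, if_neg (by omega), LinearMap.zero_apply]

instance : LieRing (M0 K n) where
  add_lie x y z := ext_entry fun k => by
    simp only [entry_lie, map_add]; split_ifs <;> ring
  lie_add x y z := ext_entry fun k => by
    simp only [entry_lie, map_add]; split_ifs <;> ring
  lie_self x := ext_entry fun k => by
    simp only [entry_lie, map_zero]; split_ifs <;> ring
  leibniz_lie x y z := ext_entry fun k => by
    simp only [entry_lie, coord_lie, map_add]; split_ifs <;> first | omega | ring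

instance : LieAlgebra K (M0 K n) where
  lie_smul c x y := ext_entry fun k => by
    simp only [entry_lie, map_smul, smul_eq_mul]; split_ifs <;> ring

end M0

/-! ## Exterior forms in `e^2, e^3, …` and the operators `D₁` and `D₋₁` -/

/-- The exterior algebra on generators `e^i`, as the vector space whose basis consists of the
monomials `e^I = e^{i_1} ∧ … ∧ e^{i_q}` for the finite sets `I = {i_1 < … < i_q}`. Only the
generators `e^2, e^3, …` are used. -/
abbrev ExtForm (K : Type*) [Field K] : Type _ := Finset ℕ →₀ K

namespace ExtForm

variable {K : Type*} [Field K]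

variable (K) in
/-- The monomial `e^I`. -/
noncomputable def mon (I : Finset ℕ) : ExtForm K := Finsupp.single I 1

/-- The map `ξ ↦ ξ ∧ e^m`. -/
noncomputable def wedge (m : ℕ) : ExtForm K →ₗ[K] ExtForm K :=
  Finsupp.linearCombination K fun I =>
    if m ∈ I then 0 else (-1 : K) ^ (I.filter (m < ·)).card • mon K (insert m I)

/-- The derivation `D₁` with `D₁ e^2 = 0` and `D₁ e^i = e^{i-1}` for `i ≥ 3`. On a monomial it
replaces each of the factors in turn; the terms with a repeated factor vanish, and the others have
their factors in increasing order. -/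
noncomputable def D₁ : ExtForm K →ₗ[K] ExtForm K :=
  Finsupp.linearCombination K fun I =>
    ∑ i ∈ I.filter (fun i => 3 ≤ i ∧ i - 1 ∉ I), mon K (insert (i - 1) (I.erase i))

variable (K) in
/-- The form `∑_{l ≥ 0} (-1)^l D₁^l(e^I) ∧ e^{m+l}`. As `D₁` lowers the sum of the exponents of a
monomial by `1`, the terms with `l > ∑ i ∈ I, i` vanish. -/
noncomputable def altSum (I : Finset ℕ) (m : ℕ) : ExtForm K :=
  ∑ l ∈ Finset.range ((∑ i ∈ I, i) + 1), (-1 : K) ^ l • wedge (m + l) ((D₁ ^ l) (mon K I))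

/-- The operator `D₋₁`, with
`D₋₁(ξ ∧ e^i) = ∑_{l ≥ 0} (-1)^l D₁^l(ξ) ∧ e^{i+1+l}` for monomials `ξ` in `e^2, …, e^{i-1}`. -/
noncomputable def Dneg : ExtForm K →ₗ[K] ExtForm K :=
  Finsupp.linearCombination K fun I =>
    if h : I.Nonempty then altSum K (I.erase (I.max' h)) (I.max' h + 1) else 0

variable (K) in
/-- The form `ω(e^j ∧ e^{j+1}) = ∑_{l ≥ 0} (-1)^l D₁^l(e^j) ∧ e^{j+1+l}`. -/
noncomputable def omega2 (j : ℕ) : ExtForm K := altSum K {j} (j + 1)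

variable (K) in
/-- The form `ω(e^i ∧ e^j ∧ e^{j+1}) = ∑_{l ≥ 0} (-1)^l D₁^l(e^i ∧ e^j) ∧ e^{j+1+l}`, for
`i < j`. -/
noncomputable def omega3 (i j : ℕ) : ExtForm K := altSum K {i, j} (j + 1)

end ExtForm

namespace M0

variable (K : Type*) [Field K] (n : ℕ)

/-- The alternating form `e^{i_1} ∧ … ∧ e^{i_q}` on `𝔪₀(n)`, with value `det (e^{i_a}(x_b))` at
`(x_1, …, x_q)`, for `i_1 < … < i_q` the elements of `I`; it is `0` if `I` does not have
`q` elements. -/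
noncomputable def monForm (q : ℕ) (I : Finset ℕ) : M0 K n [⋀^Fin q]→ₗ[K] K :=
  if h : I.card = q then
    Matrix.detRowAlternating.compLinearMap (LinearMap.pi fun a => coord K n (I.orderEmbOfFin h a))
  else 0

/-- The alternating `q`-form on `𝔪₀(n)` given by the `q`-homogeneous part of an exterior form. -/
noncomputable def toForm (q : ℕ) : ExtForm K →ₗ[K] (M0 K n [⋀^Fin q]→ₗ[K] K) :=
  Finsupp.linearCombination K (monForm K n q)

/-- The cochain `e_l ⊗ ξ`, that is, `(x_1, …, x_q) ↦ ξ(x_1, …, x_q) e_l`. -/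
noncomputable def tensor (q l : ℕ) (ξ : ExtForm K) : M0 K n [⋀^Fin q]→ₗ[K] M0 K n :=
  (LinearMap.toSpanSingleton K (M0 K n) (e K n l)).compAlternatingMap (toForm K n q ξ)

/-- The cochain `Ψ_{j,s} = ∑_{k=0}^{n-2j-1-s} e_{2j+1+s+k} ⊗ D₋₁^k ω(e^j ∧ e^{j+1})`, for
`2j + 1 + s ≤ n`. -/
noncomputable def Psi2 (j s : ℕ) : M0 K n [⋀^Fin 2]→ₗ[K] M0 K n :=
  ∑ k ∈ Finset.range (n + 1 - (2 * j + 1 + s)),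
    tensor K n 2 (2 * j + 1 + s + k) ((ExtForm.Dneg ^ k) (ExtForm.omega2 K j))

/-- The cochain
`Ψ_{i,j,s} = ∑_{k=0}^{n-i-2j-1-s} e_{i+2j+1+s+k} ⊗ D₋₁^k ω(e^i ∧ e^j ∧ e^{j+1})`, for
`i + 2j + 1 + s ≤ n`. -/
noncomputable def Psi3 (i j s : ℕ) : M0 K n [⋀^Fin 3]→ₗ[K] M0 K n :=
  ∑ k ∈ Finset.range (n + 1 - (i + 2 * j + 1 + s)),
    tensor K n 3 (i + 2 * j + 1 + s + k) ((ExtForm.Dneg ^ k) (ExtForm.omega3 K i j))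

/-- The space `C^q_(μ)` of homogeneous cochains of degree `μ`, spanned by the
`e_l ⊗ e^{i_1} ∧ … ∧ e^{i_q}` with `i_1 + … + i_q + μ = l`. -/
def homogeneous (q : ℕ) (μ : ℤ) : Submodule K (M0 K n [⋀^Fin q]→ₗ[K] M0 K n) :=
  Submodule.span K {f | ∃ (l : ℕ) (I : Finset ℕ), l ∈ Finset.Icc 1 n ∧ I ⊆ Finset.Icc 1 n ∧
    I.card = q ∧ ((∑ i ∈ I, i : ℕ) : ℤ) + μ = l ∧ f = tensor K n q l (ExtForm.mon K I)}

variable [CharZero K]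

/-- The cohomology space `H^q(𝔪₀(n), 𝔪₀(n))` with coefficients in the adjoint representation. -/
abbrev HAd (q : ℕ) : Type _ := LieCohomology.H K (M0 K n) (M0 K n) q

/-- The subspace `H^q_μ(𝔪₀(n), 𝔪₀(n))` of the classes of homogeneous cocycles of degree `μ`. -/
noncomputable def HDeg (q : ℕ) (μ : ℤ) : Submodule K (HAd K n q) :=
  ((homogeneous K n q μ).submoduleOf (LieCohomology.cocycles K (M0 K n) (M0 K n) q)).map
    (Submodule.mkQ _)

/-- The subspace `H^q_+(𝔪₀(n), 𝔪₀(n))`, the sum of the `H^q_s(𝔪₀(n), 𝔪₀(n))` over `s ≥ 0`. -/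
noncomputable def HPlus (q : ℕ) : Submodule K (HAd K n q) := ⨆ s : ℕ, HDeg K n q (s : ℤ)

end M0

/-! Let `V` be the span of `e 2, …, e n`, an abelian ideal. For `q ≥ 2` a cochain `f` of degree `s ≥
0` takes values in `V`, so `df` vanishes on `V`. Write `f = ∑ e_l ⊗ ξ_l` on `V`. Evaluating `df` on
`e 1` and elements of `V`, the cocycle condition becomes `ξ_{l-1} = D₁ ξ_l`, so a cocycle is
determined on `V` by its last coefficient `ξ_n`, a form of weight `n - s`.

Solving for a primitive one coordinate at a time shows that a cochain of degree `s` vanishing on `V`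
is a coboundary (`mem_range_d_of_forall_coord`). Conversely, a coboundary has no term `e_n ⊗ e^I`
with `I` a set of at least two numbers `≥ 2` of sum `≤ n` (`lastCoord_of_mem_coboundaries`). Hence
`f ↦ ξ_n` embeds `H^q_+` into the forms of weight at most `n`. Distinct degrees give distinct
weights, so the sum is direct; the least weights `2 + 3` and `2 + 3 + 4` bound the degrees.

For the basis, `D₁ ∘ D₋₁ = id` and `D₁ ω = 0`, both from one telescoping sum (`D₁_altSum`), so the
`Ψ` are cocycles (`genPsi_mem_cocycles`). The last coefficient of `Ψ` is some `D₋₁^k ω(e^J ∧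
e^{j+1})` with `j = max J`: the monomial `e^J ∧ e^{j+1+k}` plus monomials with a larger greatest
index (`Dneg_pow_altSum_sub_mem`). These leading monomials run exactly once through all monomials of
weight at most `n`, so the last coefficients are unitriangular, and the classes form a basis. -/

/-! ## The differential in low filtration -/

namespace LieCohomology

variable {K L V : Type*} [Field K] [LieRing L] [LieAlgebra K L]
  [AddCommGroup V] [Module K V]

/-- Inserting in front the replacement of an omitted entry amounts, up to sign, to an update. -/
theorem map_vecCons_removeNth {q : ℕ} (f : L [⋀^Fin (q + 1)]→ₗ[K] V) (x : Fin (q + 1) → L)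
    (j : Fin (q + 1)) (y : L) :
    (-1 : ℤ) ^ (j : ℕ) • f (Matrix.vecCons y (j.removeNth x)) = f (Function.update x j y) := by
  rw [← AlternatingMap.map_insertNth, Fin.insertNth_removeNth]

theorem bracketSum_eq_zero {q : ℕ} (f : L [⋀^Fin (q + 1)]→ₗ[K] V) (x : Fin (q + 2) → L)
    (hx : ∀ i j, ⁅x i, x j⁆ = 0) : bracketSum f x = 0 := by
  refine Finset.sum_eq_zero fun i _ => Finset.sum_eq_zero fun j _ => ?_
  rw [hx]
  have : f (Matrix.vecCons 0 (j.removeNth (i.castSucc.removeNth x))) = 0 :=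
    f.map_coord_zero 0 rfl
  rw [this, smul_zero]

/-- Only the brackets with `y` survive, and the sign is absorbed by moving each bracket back to the
place of the omitted entry. -/
theorem bracketSum_vecCons {q : ℕ} (f : L [⋀^Fin (q + 1)]→ₗ[K] V) (y : L) (x : Fin (q + 1) → L)
    (hx : ∀ i j, ⁅x i, x j⁆ = 0) :
    bracketSum f (Matrix.vecCons y x) = ∑ j, f (Function.update x j ⁅y, x j⁆) := by
  rw [bracketSum, Fin.sum_univ_succ]
  rw [Finset.sum_eq_zero (s := Finset.univ), add_zero]
  · refine Finset.sum_congr (by ext; simp) fun j _ => ?_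
    rw [← map_vecCons_removeNth]
    simp only [Fin.val_zero, zero_add, Matrix.cons_val_succ, Fin.castSucc_zero,
      Matrix.cons_val_zero]
    rfl
  · intro i _
    refine Finset.sum_eq_zero fun j _ => ?_
    have h : ⁅(Matrix.vecCons y x : Fin (q + 2) → L) i.succ.castSucc,
        (Matrix.vecCons y x : Fin (q + 2) → L) j.succ⁆ = 0 := by
      rw [Fin.castSucc_succ, Matrix.cons_val_succ, Matrix.cons_val_succ, hx]
    rw [h]
    have : f (Matrix.vecCons 0 (j.removeNth (i.succ.castSucc.removeNth (Matrix.vecCons y x)))) = 0 :=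
      f.map_coord_zero 0 rfl
    rw [this, smul_zero]

variable [LieRingModule L V] [LieModule K L V]

theorem actionPart_apply {q : ℕ} (f : L [⋀^Fin q]→ₗ[K] V) (x : Fin (q + 1) → L) :
    actionPart q f x = ∑ i : Fin (q + 1), (-1 : ℤ) ^ (i : ℕ) • ⁅x i, f (i.removeNth x)⁆ := by
  simp [actionPart, AlternatingMap.alternatizeUncurryFin_apply]

variable [CharZero K]

theorem d_succ_apply {q : ℕ} (f : L [⋀^Fin (q + 1)]→ₗ[K] V) (x : Fin (q + 2) → L) :
    d K L V (q + 1) f x =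
      ∑ i : Fin (q + 2), (-1 : ℤ) ^ (i : ℕ) • ⁅x i, f (i.removeNth x)⁆ - bracketSum f x := by
  rw [← actionPart_apply]
  rfl

end LieCohomology

/-! ## Coordinates in `𝔪₀(n)` -/

namespace M0

variable {K : Type*} [Field K] {n : ℕ}

theorem coord_e (i j : ℕ) :
    coord K n i (e K n j) = if i = j ∧ 1 ≤ i ∧ i ≤ n then 1 else 0 := by
  by_cases h : 1 ≤ i ∧ i ≤ n
  · rw [coord, dif_pos h]
    change (if i - 1 + 1 = j then (1 : K) else 0) = _
    exact if_congr (by omega) rfl rfl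
  · rw [coord, dif_neg h, if_neg (by tauto), LinearMap.zero_apply]

theorem coord_of_not {i : ℕ} (h : ¬ (1 ≤ i ∧ i ≤ n)) (x : M0 K n) : coord K n i x = 0 := by
  rw [coord, dif_neg h, LinearMap.zero_apply]

theorem ext_coord {x y : M0 K n} (h : ∀ i, 1 ≤ i → i ≤ n → coord K n i x = coord K n i y) :
    x = y := by
  refine ext_entry fun k => ?_
  have := h (k + 1) (by omega) (by omega)
  rwa [coord, dif_pos (by omega)] at this

theorem lie_eq_zero {x y : M0 K n} (hx : coord K n 1 x = 0) (hy : coord K n 1 y = 0) :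
    ⁅x, y⁆ = 0 := by
  refine ext_coord fun i _ _ => ?_
  rw [coord_lie, hx, hy]
  simp

theorem coord_lie_e_one (i : ℕ) (y : M0 K n) :
    coord K n i ⁅e K n 1, y⁆ = if 3 ≤ i ∧ i ≤ n then coord K n (i - 1) y else 0 := by
  rw [coord_lie]
  refine ite_congr rfl (fun h => ?_) fun _ => rfl
  rw [coord_e, coord_e, if_pos (by omega), if_neg (by omega)]
  ring

theorem lie_e_one_e {i : ℕ} (hi : 2 ≤ i) : ⁅e K n 1, e K n i⁆ = e K n (i + 1) := by
  refine ext_coord fun k _ _ => ?_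
  rw [coord_lie_e_one, coord_e, coord_e, ← ite_and]
  exact if_congr (by omega) rfl rfl

theorem coord_one_e {i : ℕ} (hi : 2 ≤ i) : coord K n 1 (e K n i) = 0 := by
  rw [coord_e, if_neg (by omega)]

variable (K n) in
/-- The basis `e 1, …, e n`. -/
noncomputable def basis : Module.Basis (Fin n) K (M0 K n) := Pi.basisFun K (Fin n)

theorem basis_apply (k : Fin n) : basis K n k = e K n (k + 1) := by
  refine ext_entry fun i => ?_
  change Pi.basisFun K (Fin n) k i = if (i : ℕ) + 1 = k + 1 then 1 else 0
  rw [Pi.basisFun_apply, Pi.single_apply]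
  exact if_congr (by rw [Fin.ext_iff]; omega) rfl rfl

variable {V : Type*} [AddCommGroup V] [Module K V]

/-- Alternating maps agree if they agree on sequences of basis vectors `e i` with `i ≥ 2`,
and on such sequences preceded by `e 1`. -/
theorem eq_zero_of_forall_e {q : ℕ} (f : M0 K n [⋀^Fin (q + 1)]→ₗ[K] V)
    (h₀ : ∀ v : Fin (q + 1) → ℕ, (∀ i, 2 ≤ v i) → f (fun i => e K n (v i)) = 0)
    (h₁ : ∀ v : Fin q → ℕ, (∀ i, 2 ≤ v i) →
      f (Matrix.vecCons (e K n 1) fun i => e K n (v i)) = 0) : f = 0 := by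
  refine Module.Basis.ext_alternating (basis K n) fun v hv => ?_
  simp only [basis_apply, AlternatingMap.zero_apply]
  -- The index `0` stands for `e 1`. As `v` is injective it occurs at most once, and a transposition
  -- brings it to the front.
  by_cases h : ∃ a, (v a : ℕ) = 0
  · obtain ⟨a, ha⟩ := h
    have key : f ((fun i => e K n (v i + 1)) ∘ Equiv.swap 0 a) = 0 := by
      convert h₁ (fun i => v (Equiv.swap 0 a i.succ) + 1) (fun i => ?_) using 2
      · funext i
        refine Fin.cases ?_ (fun i => ?_) i
        · simp [ha]
        · simp
      · have : v (Equiv.swap 0 a i.succ) ≠ v a := by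
          intro h
          have := hv h
          rw [Equiv.swap_apply_eq_iff, Equiv.swap_apply_right] at this
          exact Fin.succ_ne_zero i this
        have : (v (Equiv.swap 0 a i.succ) : ℕ) ≠ v a := fun h => this (Fin.ext h)
        omega
    rw [AlternatingMap.map_perm] at key
    rcases Int.units_eq_one_or (Equiv.Perm.sign (Equiv.swap 0 a)) with h | h <;>
      simpa [h] using key
  · push Not at h
    exact h₀ (fun i => v i + 1) fun i => by have := h i; omega

theorem eq_zero_of_forall_coord {q : ℕ} (f : M0 K n [⋀^Fin (q + 1)]→ₗ[K] V)
    (h₀ : ∀ x : Fin (q + 1) → M0 K n, (∀ i, coord K n 1 (x i) = 0) → f x = 0)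
    (h₁ : ∀ x : Fin q → M0 K n, (∀ i, coord K n 1 (x i) = 0) →
      f (Matrix.vecCons (e K n 1) x) = 0) : f = 0 :=
  eq_zero_of_forall_e f (fun _ hv => h₀ _ fun i => coord_one_e (hv i))
    fun _ hv => h₁ _ fun i => coord_one_e (hv i)

/-! ### The differential of the adjoint representation -/

open LieCohomology

variable [CharZero K]

theorem d_apply_of_coord_one {q : ℕ} (f : M0 K n [⋀^Fin (q + 1)]→ₗ[K] M0 K n)
    (x : Fin (q + 2) → M0 K n) (hx : ∀ i, coord K n 1 (x i) = 0) :
    d K (M0 K n) (M0 K n) (q + 1) f x =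
      ∑ i : Fin (q + 2), (-1 : ℤ) ^ (i : ℕ) • ⁅x i, f (i.removeNth x)⁆ := by
  rw [d_succ_apply, bracketSum_eq_zero f x fun i j => lie_eq_zero (hx i) (hx j), sub_zero]

/-- Arguments and values all lie in the abelian ideal spanned by `e 2, …, e n`. -/
theorem d_apply_eq_zero {q : ℕ} (f : M0 K n [⋀^Fin (q + 1)]→ₗ[K] M0 K n)
    (hf : ∀ x, coord K n 1 (f x) = 0)
    (x : Fin (q + 2) → M0 K n) (hx : ∀ i, coord K n 1 (x i) = 0) :
    d K (M0 K n) (M0 K n) (q + 1) f x = 0 := by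
  rw [d_apply_of_coord_one f x hx]
  exact Finset.sum_eq_zero fun i _ => by rw [lie_eq_zero (hx i) (hf _), smul_zero]

/-- For a cocycle this says that `f` commutes with the action of `e 1`. -/
theorem d_apply_vecCons {q : ℕ} (f : M0 K n [⋀^Fin (q + 1)]→ₗ[K] M0 K n)
    (hf : ∀ x, coord K n 1 (f x) = 0)
    (x : Fin (q + 1) → M0 K n) (hx : ∀ i, coord K n 1 (x i) = 0) :
    d K (M0 K n) (M0 K n) (q + 1) f (Matrix.vecCons (e K n 1) x) =
      ⁅e K n 1, f x⁆ - ∑ j, f (Function.update x j ⁅e K n 1, x j⁆) := by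
  rw [d_succ_apply, bracketSum_vecCons f _ x fun i j => lie_eq_zero (hx i) (hx j),
    Fin.sum_univ_succ, Finset.sum_eq_zero (s := Finset.univ), add_zero]
  · simp only [Fin.val_zero, pow_zero, one_smul]
    rfl
  · intro i _
    rw [Matrix.cons_val_succ, lie_eq_zero (hx i) (hf _), smul_zero]

end M0

/-! ## The operators on exterior forms -/

namespace ExtForm

variable {K : Type*} [Field K]

theorem linearCombination_mon {M : Type*} [AddCommGroup M] [Module K M] (g : Finset ℕ → M)
    (I : Finset ℕ) : Finsupp.linearCombination K g (mon K I) = g I := by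
  rw [mon, Finsupp.linearCombination_single, one_smul]

theorem D₁_mon (I : Finset ℕ) : D₁ (mon K I) =
    ∑ i ∈ I.filter (fun i => 3 ≤ i ∧ i - 1 ∉ I), mon K (insert (i - 1) (I.erase i)) :=
  linearCombination_mon _ I

theorem wedge_mon_of_lt {I : Finset ℕ} {m : ℕ} (h : ∀ i ∈ I, i < m) :
    wedge m (mon K I) = mon K (insert m I) := by
  rw [wedge, linearCombination_mon, if_neg fun hm => (h m hm).false,
    Finset.filter_false_of_mem fun i hi => (h i hi).not_gt, Finset.card_empty, pow_zero, one_smul]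

theorem wedge_mon_of_mem {I : Finset ℕ} {m : ℕ} (h : m ∈ I) : wedge m (mon K I) = 0 := by
  rw [wedge, linearCombination_mon, if_pos h]

theorem Dneg_mon {I : Finset ℕ} {c : ℕ} (h : ∀ i ∈ I, i < c) :
    Dneg (mon K (insert c I)) = altSum K I (c + 1) := by
  have hne : (insert c I).Nonempty := Finset.insert_nonempty c I
  have hmax : (insert c I).max' hne = c := by
    refine le_antisymm (Finset.max'_le _ _ _ fun i hi => ?_)
      (Finset.le_max' _ _ (Finset.mem_insert_self c I))
    rcases Finset.mem_insert.1 hi with rfl | hi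
    · exact le_rfl
    · exact (h i hi).le
  rw [Dneg, linearCombination_mon, dif_pos hne, hmax,
    Finset.erase_insert fun hc => (h c hc).false]

theorem mon_mem {S : Set (Finset ℕ)} {I : Finset ℕ} (h : I ∈ S) :
    mon K I ∈ Finsupp.supported K K S :=
  Finsupp.single_mem_supported K 1 h

section supported

variable {M : Type*} [AddCommGroup M] [Module K M] {S : Set (Finset ℕ)} {ξ : ExtForm K}

theorem map_mem_of_mon (hξ : ξ ∈ Finsupp.supported K K S) (f : ExtForm K →ₗ[K] M)
    (p : Submodule K M) (h : ∀ I ∈ S, f (mon K I) ∈ p) : f ξ ∈ p := by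
  rw [Finsupp.supported_eq_span_single] at hξ
  have : Submodule.span K ((fun i => Finsupp.single i (1 : K)) '' S) ≤ p.comap f := by
    rw [Submodule.span_le]
    rintro _ ⟨I, hI, rfl⟩
    exact h I hI
  exact this hξ

theorem eq_of_mon (hξ : ξ ∈ Finsupp.supported K K S) (f g : ExtForm K →ₗ[K] M)
    (h : ∀ I ∈ S, f (mon K I) = g (mon K I)) : f ξ = g ξ := by
  have := map_mem_of_mon hξ (f - g) ⊥ fun I hI => by simp [h I hI]
  simpa [sub_eq_zero] using this

end supported

/-- The sets of `q` numbers between `2` and `m - 1` whose sum is `w - l`. -/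
def boundedSets (q m w l : ℕ) : Set (Finset ℕ) :=
  {I | I.card = q ∧ (∀ i ∈ I, 2 ≤ i ∧ i < m) ∧ ∑ i ∈ I, i + l = w}

/-- The sets of `q` numbers greater than `1` whose sum is `w`. -/
def weightSets (q w : ℕ) : Set (Finset ℕ) :=
  {I | I.card = q ∧ (∀ i ∈ I, 2 ≤ i) ∧ ∑ i ∈ I, i = w}

/-- The sets with an element greater than `c`. -/
def setsAbove (c : ℕ) : Set (Finset ℕ) := {I | ∃ i ∈ I, c < i}

theorem D₁_mem {q m w l : ℕ} {ξ : ExtForm K}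
    (hξ : ξ ∈ Finsupp.supported K K (boundedSets q m w l)) :
    D₁ ξ ∈ Finsupp.supported K K (boundedSets q m w (l + 1)) := by
  refine map_mem_of_mon hξ D₁ _ fun I ⟨hq, hb, hw⟩ => ?_
  rw [D₁_mon]
  refine Submodule.sum_mem _ fun i hi => mon_mem ?_
  obtain ⟨hi, h3, hn⟩ := Finset.mem_filter.1 hi
  have hn' : i - 1 ∉ I.erase i := fun h => hn (Finset.mem_of_mem_erase h)
  refine ⟨?_, fun k hk => ?_, ?_⟩
  · rw [Finset.card_insert_of_notMem hn', Finset.card_erase_add_one hi, hq]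
  · rcases Finset.mem_insert.1 hk with rfl | hk
    · have := hb i hi
      omega
    · exact hb k (Finset.mem_of_mem_erase hk)
  · rw [Finset.sum_insert hn', ← hw, ← Finset.add_sum_erase I _ hi]
    omega

theorem D₁_pow_mem {q m w l : ℕ} {ξ : ExtForm K}
    (hξ : ξ ∈ Finsupp.supported K K (boundedSets q m w 0)) :
    (D₁ ^ l) ξ ∈ Finsupp.supported K K (boundedSets q m w l) := by
  induction l with
  | zero => exact hξ
  | succ l ih => rw [pow_succ']; exact D₁_mem ih

/-- The sum of the indices drops by one at each step. This justifies the cutoff in `altSum`. -/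
theorem D₁_pow_eq_zero {q m w l : ℕ} {ξ : ExtForm K}
    (hξ : ξ ∈ Finsupp.supported K K (boundedSets q m w 0)) (hl : w < l) : (D₁ ^ l) ξ = 0 := by
  have h := D₁_pow_mem (l := l) hξ
  have : boundedSets q m w l = ∅ := by
    ext I
    simp only [boundedSets, Set.mem_ofPred_eq, Set.mem_empty_iff_false, iff_false]
    omega
  rwa [this, Finsupp.supported_empty, Submodule.mem_bot] at h

theorem mon_mem_boundedSets {J : Finset ℕ} {m : ℕ} (hJ : ∀ i ∈ J, 2 ≤ i ∧ i < m) :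
    mon K J ∈ Finsupp.supported K K (boundedSets J.card m (∑ i ∈ J, i) 0) :=
  mon_mem ⟨rfl, hJ, rfl⟩

/-- The Leibniz rule with `D₁ e^{k+1} = e^k`. Since the indices in `ξ` are below `k + 1`, the new
factor comes last and no signs appear. -/
theorem D₁_wedge {q m w l : ℕ} {ξ : ExtForm K} {k : ℕ} (hm : 2 ≤ k) (hk : m ≤ k + 1)
    (hξ : ξ ∈ Finsupp.supported K K (boundedSets q m w l)) :
    D₁ (wedge (k + 1) ξ) = wedge (k + 1) (D₁ ξ) + wedge k ξ := by
  refine eq_of_mon hξ (D₁ ∘ₗ wedge (k + 1)) (wedge (k + 1) ∘ₗ D₁ + wedge k) fun I ⟨_, hb, _⟩ => ?_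
  have hlt : ∀ i ∈ I, i < k + 1 := fun i hi => (hb i hi).2.trans_le hk
  have hkI : k + 1 ∉ I := fun h => (hlt _ h).false
  rw [LinearMap.comp_apply, LinearMap.add_apply, LinearMap.comp_apply, wedge_mon_of_lt hlt,
    D₁_mon, D₁_mon, map_sum, Finset.filter_insert, add_comm (Finset.sum _ _)]
  have key : ∑ i ∈ I.filter (fun i => 3 ≤ i ∧ i - 1 ∉ insert (k + 1) I),
        mon K (insert (i - 1) ((insert (k + 1) I).erase i)) =
      ∑ i ∈ I.filter (fun i => 3 ≤ i ∧ i - 1 ∉ I),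
        wedge (k + 1) (mon K (insert (i - 1) (I.erase i))) := by
    have hf : I.filter (fun i => 3 ≤ i ∧ i - 1 ∉ insert (k + 1) I) =
        I.filter (fun i => 3 ≤ i ∧ i - 1 ∉ I) := by
      refine Finset.filter_congr fun i hi => ?_
      have := hlt i hi
      rw [Finset.mem_insert, not_or]
      exact and_congr_right fun _ => and_iff_right (by omega)
    rw [hf]
    refine Finset.sum_congr rfl fun i hi => ?_
    have hi' := hlt i (Finset.mem_filter.1 hi).1
    rw [wedge_mon_of_lt, Finset.erase_insert_of_ne (by omega), Finset.insert_comm]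
    intro a ha
    rcases Finset.mem_insert.1 ha with rfl | ha
    · omega
    · exact hlt a (Finset.mem_of_mem_erase ha)
  -- If `k ∈ I`, lowering `k + 1` would repeat a factor, and `wedge k` vanishes as well.
  by_cases hmem : k ∈ I
  · rw [if_neg (by simp [hmem]), key, wedge_mon_of_mem hmem, zero_add]
  · have hlt' : ∀ i ∈ I, i < k := fun i hi => by
      have := hlt i hi
      have : i ≠ k := fun h => hmem (h ▸ hi)
      omega
    rw [if_pos ⟨by omega, by simp [hmem]⟩, Finset.sum_insert (by simp [hkI]), key,
      wedge_mon_of_lt hlt', Finset.erase_insert hkI, Nat.add_sub_cancel]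

/-- By the Leibniz rule the alternating sum telescopes to its term at `l = 0`. With `k ∈ J` this
gives `D₁ ω = 0`; with `k` above all of `J` it gives `D₁ ∘ D₋₁ = id`. -/
theorem D₁_altSum {J : Finset ℕ} {k : ℕ} (hk : 2 ≤ k) (hJ : ∀ i ∈ J, 2 ≤ i ∧ i < k + 1) :
    D₁ (altSum K J (k + 1)) = wedge k (mon K J) := by
  have hb := mon_mem_boundedSets (K := K) hJ
  have h (l : ℕ) : D₁ ((-1 : K) ^ l • wedge (k + 1 + l) ((D₁ ^ l) (mon K J))) =
      (-1 : K) ^ l • wedge (k + l) ((D₁ ^ l) (mon K J)) -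
        (-1 : K) ^ (l + 1) • wedge (k + (l + 1)) ((D₁ ^ (l + 1)) (mon K J)) := by
    rw [map_smul, show k + 1 + l = k + l + 1 by omega,
      D₁_wedge (by omega) (by omega) (D₁_pow_mem hb), pow_succ' D₁, Module.End.mul_apply,
      pow_succ, smul_add, ← add_assoc]
    module
  rw [altSum, map_sum, Finset.sum_congr rfl fun l _ => h l,
    Finset.sum_range_sub' fun l => (-1 : K) ^ l • wedge (k + l) ((D₁ ^ l) (mon K J)),
    D₁_pow_eq_zero hb (Nat.lt_succ_self _)]
  simp

theorem altSum_mem {J : Finset ℕ} {m : ℕ} (hm : 2 ≤ m) (hJ : ∀ i ∈ J, 2 ≤ i ∧ i < m) :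
    altSum K J m ∈ Finsupp.supported K K (weightSets (J.card + 1) (∑ i ∈ J, i + m)) := by
  refine Submodule.sum_mem _ fun l _ => Submodule.smul_mem _ _ ?_
  refine map_mem_of_mon (D₁_pow_mem (l := l) (mon_mem_boundedSets (K := K) hJ))
    (wedge (m + l)) _ fun I ⟨hq, hb, hw⟩ => ?_
  have hlt : ∀ i ∈ I, i < m + l := fun i hi => (hb i hi).2.trans_le (by omega)
  have hn : m + l ∉ I := fun h => (hlt _ h).false
  rw [wedge_mon_of_lt hlt]
  refine mon_mem ⟨by rw [Finset.card_insert_of_notMem hn, hq], fun i hi => ?_, ?_⟩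
  · rcases Finset.mem_insert.1 hi with rfl | hi
    · omega
    · exact (hb i hi).1
  · rw [Finset.sum_insert hn]
    omega

/-- The removed monomial is the term `l = 0`; each later term contains `e^{m+l}` with `l > 0`. -/
theorem altSum_sub_mem {J : Finset ℕ} {m : ℕ} (hJ : ∀ i ∈ J, 2 ≤ i ∧ i < m) :
    altSum K J m - mon K (insert m J) ∈ Finsupp.supported K K (setsAbove m) := by
  rw [altSum, Finset.sum_range_succ']
  simp only [pow_zero, Module.End.one_apply, one_smul, add_zero]
  rw [wedge_mon_of_lt fun i hi => (hJ i hi).2, add_sub_cancel_right]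
  refine Submodule.sum_mem _ fun l _ => Submodule.smul_mem _ _ ?_
  refine map_mem_of_mon (D₁_pow_mem (l := l + 1) (mon_mem_boundedSets (K := K) hJ))
    (wedge (m + (l + 1))) _ fun I ⟨_, hb, _⟩ => ?_
  rw [wedge_mon_of_lt fun i hi => (hb i hi).2.trans_le (by omega)]
  exact mon_mem ⟨_, Finset.mem_insert_self _ _, by omega⟩

/-- A nonempty set is obtained by adding to a set a number greater than its elements. -/
theorem exists_eq_insert {I : Finset ℕ} (h : I.Nonempty) :
    ∃ J c, I = insert c J ∧ ∀ i ∈ J, i < c :=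
  ⟨I.erase (I.max' h), I.max' h, (Finset.insert_erase (I.max'_mem h)).symm,
    fun _ hi => lt_of_le_of_ne (I.le_max' _ (Finset.mem_of_mem_erase hi)) (Finset.ne_of_mem_erase hi)⟩

section Dneg

variable {q w : ℕ} {ξ : ExtForm K}

theorem exists_insert_of_mem_weightSets {I : Finset ℕ} (hI : I ∈ weightSets (q + 1) w) :
    ∃ J c, I = insert c J ∧ (∀ i ∈ J, 2 ≤ i ∧ i < c) ∧ 2 ≤ c ∧ J.card = q ∧
      ∑ i ∈ J, i + c = w := by
  obtain ⟨hq, hb, hw⟩ := hI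
  obtain ⟨J, c, rfl, hJ⟩ := exists_eq_insert (I := I) (Finset.card_pos.1 (by omega))
  have hn : c ∉ J := fun h => (hJ c h).false
  refine ⟨J, c, rfl, fun i hi => ⟨hb i (Finset.mem_insert_of_mem hi), hJ i hi⟩,
    hb c (Finset.mem_insert_self c J), ?_, ?_⟩
  · rw [Finset.card_insert_of_notMem hn] at hq
    omega
  · rw [Finset.sum_insert hn] at hw
    omega

theorem Dneg_mem (hξ : ξ ∈ Finsupp.supported K K (weightSets (q + 1) w)) :
    Dneg ξ ∈ Finsupp.supported K K (weightSets (q + 1) (w + 1)) := by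
  refine map_mem_of_mon hξ Dneg _ fun I hI => ?_
  obtain ⟨J, c, rfl, hJ, hc, rfl, rfl⟩ := exists_insert_of_mem_weightSets hI
  rw [Dneg_mon fun i hi => (hJ i hi).2]
  exact altSum_mem (by omega) fun i hi => ⟨(hJ i hi).1, (hJ i hi).2.trans c.lt_succ_self⟩

theorem Dneg_pow_mem (hξ : ξ ∈ Finsupp.supported K K (weightSets (q + 1) w)) (k : ℕ) :
    (Dneg ^ k) ξ ∈ Finsupp.supported K K (weightSets (q + 1) (w + k)) := by
  induction k with
  | zero => exact hξ
  | succ k ih => rw [pow_succ']; exact Dneg_mem ih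

theorem D₁_Dneg (hξ : ξ ∈ Finsupp.supported K K (weightSets (q + 1) w)) : D₁ (Dneg ξ) = ξ := by
  refine eq_of_mon hξ (D₁ ∘ₗ Dneg) LinearMap.id fun I hI => ?_
  obtain ⟨J, c, rfl, hJ, hc, rfl, rfl⟩ := exists_insert_of_mem_weightSets hI
  rw [LinearMap.comp_apply, Dneg_mon fun i hi => (hJ i hi).2,
    D₁_altSum hc fun i hi => ⟨(hJ i hi).1, (hJ i hi).2.trans c.lt_succ_self⟩,
    wedge_mon_of_lt fun i hi => (hJ i hi).2, LinearMap.id_apply]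

/-- The greatest index of every monomial is raised by at least one. -/
theorem Dneg_mem_setsAbove {c : ℕ}
    (hξ : ξ ∈ Finsupp.supported K K (weightSets (q + 1) w ∩ setsAbove c)) :
    Dneg ξ ∈ Finsupp.supported K K (setsAbove (c + 1)) := by
  refine map_mem_of_mon hξ Dneg _ fun I hI => ?_
  obtain ⟨J, m, rfl, hJ, hm, -, -⟩ := exists_insert_of_mem_weightSets hI.1
  obtain ⟨i, hi, hci⟩ := hI.2
  have hcm : c < m := by
    rcases Finset.mem_insert.1 hi with rfl | hi
    · exact hci
    · exact hci.trans (hJ i hi).2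
  rw [Dneg_mon fun i hi => (hJ i hi).2, ← sub_add_cancel (altSum K J (m + 1)) (mon K (insert (m + 1) J))]
  refine Submodule.add_mem _ (Finsupp.supported_mono ?_ (altSum_sub_mem fun i hi =>
    ⟨(hJ i hi).1, (hJ i hi).2.trans m.lt_succ_self⟩)) (mon_mem ⟨m + 1, by simp, by omega⟩)
  rintro I ⟨i, hi, h⟩
  exact ⟨i, hi, by omega⟩

/-- The leading term of `D₋₁^k ω(…)`. -/
theorem Dneg_pow_altSum_sub_mem {J : Finset ℕ} {m : ℕ} (hm : 2 ≤ m)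
    (hJ : ∀ i ∈ J, 2 ≤ i ∧ i < m) (k : ℕ) :
    (Dneg ^ k) (altSum K J m) - mon K (insert (m + k) J) ∈
      Finsupp.supported K K (setsAbove (m + k)) := by
  induction k with
  | zero => exact altSum_sub_mem hJ
  | succ k ih =>
    have hJ' : ∀ i ∈ J, 2 ≤ i ∧ i < m + k := fun i hi => ⟨(hJ i hi).1, by have := (hJ i hi).2; omega⟩
    have hJ'' : ∀ i ∈ J, 2 ≤ i ∧ i < m + k + 1 :=
      fun i hi => ⟨(hJ i hi).1, by have := (hJ i hi).2; omega⟩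
    have hn : m + k ∉ J := fun h => (hJ' _ h).2.false
    have hmon : mon K (insert (m + k) J) ∈
        Finsupp.supported K K (weightSets (J.card + 1) (∑ i ∈ J, i + m + k)) := by
      refine mon_mem ⟨Finset.card_insert_of_notMem hn, fun i hi => ?_, ?_⟩
      · rcases Finset.mem_insert.1 hi with rfl | hi
        · omega
        · exact (hJ i hi).1
      · rw [Finset.sum_insert hn]
        omega
    have h := Submodule.sub_mem _ (Dneg_pow_mem (altSum_mem (K := K) hm hJ) k) hmon
    -- The old remainder is pushed above `m + k + 1`, while the old leading monomial yields the new
    -- one plus terms above it.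
    have h' := Dneg_mem_setsAbove (K := K) (by
      rw [Finsupp.supported_inter]
      exact ⟨h, ih⟩)
    rw [map_sub, Dneg_mon fun i hi => (hJ' i hi).2] at h'
    have := Submodule.add_mem _ h' (altSum_sub_mem (K := K) hJ'')
    rwa [sub_add_sub_cancel, ← Module.End.mul_apply, ← pow_succ'] at this

end Dneg

end ExtForm

/-! ## Exterior forms as alternating maps -/

/-- Expanding along the replaced row or column, both sides are the sum of the entries of `N` times
the corresponding cofactors of `M`. This trades a derivation over the arguments of a form for one
over its factors. -/
theorem Matrix.sum_det_updateRow {R ι : Type*} [CommRing R] [Fintype ι] [DecidableEq ι]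
    (M N : Matrix ι ι R) :
    ∑ j, (M.updateRow j (N j)).det = ∑ a, (M.updateCol a fun b => N b a).det := by
  simp only [← Matrix.cramer_transpose_apply, ← Matrix.cramer_apply,
    Matrix.cramer_eq_adjugate_mulVec, ← Matrix.adjugate_transpose, Matrix.mulVec, dotProduct,
    Matrix.transpose_apply]
  exact Finset.sum_comm

namespace M0

open ExtForm

variable {K : Type*} [Field K] {n q : ℕ}

section evalAt

variable {V : Type*} [AddCommGroup V] [Module K V]

/-- Evaluation of alternating maps at a sequence of vectors. -/
def evalAt (x : Fin q → M0 K n) : (M0 K n [⋀^Fin q]→ₗ[K] V) →ₗ[K] V where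
  toFun f := f x
  map_add' _ _ := rfl
  map_smul' _ _ := rfl

theorem evalAt_apply (x : Fin q → M0 K n) (f : M0 K n [⋀^Fin q]→ₗ[K] V) : evalAt x f = f x := rfl

theorem sum_apply {ι : Type*} (s : Finset ι) (f : ι → M0 K n [⋀^Fin q]→ₗ[K] V)
    (x : Fin q → M0 K n) : (∑ i ∈ s, f i) x = ∑ i ∈ s, f i x :=
  map_sum (evalAt x) f s

end evalAt

theorem monForm_apply {I : Finset ℕ} (h : I.card = q) (x : Fin q → M0 K n) :
    monForm K n q I x =
      (Matrix.of fun b a => coord K n (I.orderEmbOfFin h a) (x b)).det := by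
  rw [monForm, dif_pos h]
  rfl

theorem toForm_mon (I : Finset ℕ) : toForm K n q (mon K I) = monForm K n q I :=
  linearCombination_mon _ I

theorem monForm_e_eq_zero {I : Finset ℕ} {v : Fin q → ℕ} {i : ℕ} (hi : i ∈ I)
    (hv : ∀ b, i ≠ v b) : monForm K n q I (fun b => e K n (v b)) = 0 := by
  by_cases h : I.card = q
  · rw [monForm_apply h]
    rw [← Finset.mem_coe, ← Finset.range_orderEmbOfFin I h] at hi
    obtain ⟨a, rfl⟩ := hi
    refine Matrix.det_eq_zero_of_column_eq_zero a fun b => ?_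
    rw [Matrix.of_apply, coord_e, if_neg fun h => hv b h.1]
  · rw [monForm, dif_neg h, AlternatingMap.zero_apply]

theorem sum_orderEmbOfFin {M : Type*} [AddCommMonoid M] {I : Finset ℕ} (h : I.card = q)
    (g : ℕ → M) : ∑ a, g (I.orderEmbOfFin h a) = ∑ i ∈ I, g i := by
  conv_rhs => rw [← Finset.map_orderEmbOfFin_univ I h]
  rw [Finset.sum_map]
  rfl

/-- A nonzero value forces every index of `I` to occur in `v`; by injectivity the match is a
bijection, so the sums agree. -/
theorem monForm_e_of_sum_ne {I : Finset ℕ} {v : Fin q → ℕ} (h : ∑ i ∈ I, i ≠ ∑ b, v b) :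
    monForm K n q I (fun b => e K n (v b)) = 0 := by
  by_cases hq : I.card = q
  · by_contra hne
    have h' : ∀ a, ∃ b, I.orderEmbOfFin hq a = v b := by
      intro a
      by_contra hb
      push Not at hb
      exact hne (monForm_e_eq_zero (I.orderEmbOfFin_mem hq a) hb)
    choose σ hσ using h'
    have hinj : Function.Injective σ := fun a b hab =>
      (I.orderEmbOfFin hq).injective (by rw [hσ, hσ, hab])
    have hbij := Finite.injective_iff_bijective.1 hinj
    refine h ?_
    rw [← sum_orderEmbOfFin hq, ← hbij.sum_comp v]
    exact Finset.sum_congr rfl fun a _ => hσ a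
  · rw [monForm, dif_neg hq, AlternatingMap.zero_apply]

theorem monForm_e_self {I : Finset ℕ} (h : I.card = q) (hI : ∀ i ∈ I, 1 ≤ i ∧ i ≤ n) :
    monForm K n q I (fun b => e K n (I.orderEmbOfFin h b)) = 1 := by
  rw [monForm_apply h]
  refine (congrArg Matrix.det ?_).trans Matrix.det_one
  ext b a
  rw [Matrix.of_apply, coord_e, Matrix.one_apply]
  have := hI _ (I.orderEmbOfFin_mem h a)
  refine if_congr ⟨fun h' => ((I.orderEmbOfFin h).injective h'.1).symm, fun h' => ⟨by rw [h'], this⟩⟩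
    rfl rfl

theorem le_of_mem_weightSets {w : ℕ} {I : Finset ℕ} (hI : I ∈ weightSets q w) {i : ℕ}
    (hi : i ∈ I) : 2 ≤ i ∧ i ≤ w :=
  ⟨hI.2.1 i hi, hI.2.2 ▸ Finset.single_le_sum (f := fun i => i) (fun _ _ => Nat.zero_le _) hi⟩

/-- The bound `w ≤ n` keeps every index in range, so no monomial of `ξ` becomes zero on `𝔪₀(n)`. -/
theorem toForm_e {w : ℕ} (hw : w ≤ n) {ξ : ExtForm K}
    (hξ : ξ ∈ Finsupp.supported K K (weightSets q w)) {I : Finset ℕ} (h : I.card = q) :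
    toForm K n q ξ (fun b => e K n (I.orderEmbOfFin h b)) = ξ I := by
  have := eq_of_mon hξ
    (evalAt (fun b => e K n (I.orderEmbOfFin h b)) ∘ₗ toForm K n q)
    (Finsupp.lapply I) fun J hJ => ?_
  · exact this
  · rw [LinearMap.comp_apply, toForm_mon, mon, Finsupp.lapply_apply, evalAt_apply]
    by_cases hJI : J = I
    · subst hJI
      rw [Finsupp.single_eq_same, monForm_e_self]
      intro i hi
      have := le_of_mem_weightSets hJ hi
      omega
    · rw [Finsupp.single_eq_of_ne (Ne.symm hJI)]
      have : ∃ i ∈ J, i ∉ I := by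
        by_contra! hsub
        exact hJI (Finset.eq_of_subset_of_card_le hsub (by rw [h, hJ.1]))
      obtain ⟨i, hi, hiI⟩ := this
      exact monForm_e_eq_zero hi fun b hb => hiI (hb ▸ I.orderEmbOfFin_mem h b)

/-- The derivation `D₁` is dual to the action of `e 1`. -/
theorem toForm_D₁_mon {I : Finset ℕ} (h : I.card = q) (hI : ∀ i ∈ I, 2 ≤ i ∧ i ≤ n)
    (x : Fin q → M0 K n) : toForm K n q (D₁ (mon K I)) x =
      ∑ j, monForm K n q I (Function.update x j ⁅e K n 1, x j⁆) := by
  set ι := I.orderEmbOfFin h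
  have hι : ∀ a, ι a ∈ I := I.orderEmbOfFin_mem h
  have hrow (j : Fin q) : monForm K n q I (Function.update x j ⁅e K n 1, x j⁆) =
      ((Matrix.of fun b a => coord K n (ι a) (x b)).updateRow j
        ((Matrix.of fun b a => coord K n (ι a) ⁅e K n 1, x b⁆) j)).det := by
    rw [monForm_apply h]
    congr 1
    ext b a
    rw [Matrix.updateRow_apply, Matrix.of_apply]
    split_ifs with hb
    · subst hb
      rw [Function.update_self, Matrix.of_apply]
    · rw [Function.update_of_ne hb, Matrix.of_apply]
  -- The sum over replaced rows (arguments) becomes a sum over replaced columns (factors), to be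
  -- matched with `D₁` factor by factor.
  rw [Finset.sum_congr rfl fun j _ => hrow j, Matrix.sum_det_updateRow, D₁_mon, map_sum,
    sum_apply, Finset.sum_filter, ← sum_orderEmbOfFin h]
  refine Finset.sum_congr rfl fun a _ => ?_
  change (if 3 ≤ ι a ∧ ι a - 1 ∉ I then toForm K n q (mon K (insert (ι a - 1) (I.erase (ι a)))) x
    else 0) = _
  have hle := hI _ (hι a)
  by_cases h3 : 3 ≤ ι a
  · have hcol : (fun b => Matrix.of (fun b a => coord K n (ι a) ⁅e K n 1, x b⁆) b a) =
        fun b => coord K n (ι a - 1) (x b) := by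
      funext b
      rw [Matrix.of_apply, coord_lie_e_one, if_pos ⟨h3, hle.2⟩]
    rw [hcol]
    -- If the lowered index is already in `I`, two columns coincide.
    by_cases hmem : ι a - 1 ∈ I
    · rw [if_neg fun h => h.2 hmem]
      obtain ⟨c, hc⟩ : ∃ c, ι c = ι a - 1 := by
        rw [← Finset.mem_coe, ← Finset.range_orderEmbOfFin I h] at hmem
        exact hmem
      have hac : a ≠ c := by
        rintro rfl
        omega
      refine (Matrix.det_zero_of_column_eq hac fun b => ?_).symm
      rw [Matrix.updateCol_self, Matrix.updateCol_ne hac.symm, Matrix.of_apply, hc]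
    · have hn : ι a - 1 ∉ I.erase (ι a) := fun h => hmem (Finset.mem_of_mem_erase h)
      have hcard : (insert (ι a - 1) (I.erase (ι a))).card = q := by
        rw [Finset.card_insert_of_notMem hn, Finset.card_erase_add_one (hι a), h]
      -- Lowering an index by one to a free place preserves the increasing order, so no sign arises.
      have huniq : Function.update ι a (ι a - 1) =
          (insert (ι a - 1) (I.erase (ι a))).orderEmbOfFin hcard := by
        have hne (b : Fin q) : ι b ≠ ι a - 1 := fun h => hmem (h ▸ hι b)
        refine Finset.orderEmbOfFin_unique hcard (fun b => ?_) fun b c hbc => ?_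
        · rcases eq_or_ne b a with rfl | hb
          · rw [Function.update_self]
            exact Finset.mem_insert_self _ _
          · rw [Function.update_of_ne hb]
            exact Finset.mem_insert_of_mem
              (Finset.mem_erase.2 ⟨fun h => hb (ι.injective h), hι b⟩)
        · have hlt : ι b < ι c := ι.strictMono hbc
          have := hne b
          rcases eq_or_ne b a with rfl | hb
          · rw [Function.update_self, Function.update_of_ne hbc.ne']
            omega
          · rw [Function.update_of_ne hb]
            rcases eq_or_ne c a with rfl | hc
            · rw [Function.update_self]
              omega
            · rwa [Function.update_of_ne hc]
      rw [if_pos ⟨h3, hmem⟩, toForm_mon, monForm_apply hcard, ← huniq]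
      congr 1
      ext b c
      rw [Matrix.updateCol_apply, Matrix.of_apply]
      split_ifs with hc
      · rw [hc, Function.update_self]
      · rw [Function.update_of_ne hc, Matrix.of_apply]
  · rw [if_neg fun h => h3 h.1]
    refine (Matrix.det_eq_zero_of_column_eq_zero a fun b => ?_).symm
    rw [Matrix.updateCol_self, Matrix.of_apply, coord_lie_e_one, if_neg fun h => h3 h.1]

/-- The bound `w ≤ n` matters: `e^{n+1}` is zero on `𝔪₀(n)`, but `D₁ e^{n+1} = e^n` is not. -/
theorem toForm_D₁ {w : ℕ} (hw : w ≤ n) {ξ : ExtForm K}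
    (hξ : ξ ∈ Finsupp.supported K K (weightSets q w)) (x : Fin q → M0 K n) :
    toForm K n q (D₁ ξ) x = ∑ j, toForm K n q ξ (Function.update x j ⁅e K n 1, x j⁆) := by
  have := eq_of_mon hξ (evalAt x ∘ₗ toForm K n q ∘ₗ D₁)
    (∑ j, evalAt (Function.update x j ⁅e K n 1, x j⁆) ∘ₗ toForm K n q) fun I hI => ?_
  · simpa [evalAt_apply, LinearMap.sum_apply] using this
  · simp only [LinearMap.sum_apply, LinearMap.comp_apply, toForm_mon, evalAt_apply]
    refine toForm_D₁_mon hI.1 (fun i hi => ?_) x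
    have := le_of_mem_weightSets hI hi
    omega

theorem tensor_apply (l : ℕ) (ξ : ExtForm K) (x : Fin q → M0 K n) :
    tensor K n q l ξ x = toForm K n q ξ x • e K n l := rfl

end M0

/-! ## Coboundaries of nonnegative degree -/

namespace M0

open LieCohomology ExtForm

variable {K : Type*} [Field K] {n q s : ℕ}

theorem vecCons_e (i : ℕ) (v : Fin q → ℕ) : (Matrix.vecCons (e K n i) fun b => e K n (v b)) =
    fun b => e K n (Matrix.vecCons i v b) := by
  funext b
  refine Fin.cases ?_ (fun b => ?_) b <;> simp

theorem update_e (v : Fin q → ℕ) (j : Fin q) (i : ℕ) :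
    Function.update (fun b => e K n (v b)) j (e K n i) =
      fun b => e K n (Function.update v j i b) := by
  funext b
  rcases eq_or_ne b j with rfl | h
  · rw [Function.update_self, Function.update_self]
  · rw [Function.update_of_ne h, Function.update_of_ne h]

theorem update_lie_e {v : Fin q → ℕ} (hv : ∀ i, 2 ≤ v i) (j : Fin q) :
    Function.update (fun b => e K n (v b)) j ⁅e K n 1, e K n (v j)⁆ =
      fun b => e K n (Function.update v j (v j + 1) b) := by
  rw [lie_e_one_e (hv j), update_e]

theorem two_le_update {v : Fin q → ℕ} (hv : ∀ i, 2 ≤ v i) (j : Fin q) (b : Fin q) :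
    2 ≤ Function.update v j (v j + 1) b := by
  rcases eq_or_ne b j with rfl | h
  · rw [Function.update_self]
    have := hv b
    omega
  · rw [Function.update_of_ne h]
    exact hv b

theorem sum_update (v : Fin q → ℕ) (j : Fin q) :
    ∑ b, Function.update v j (v j + 1) b = ∑ b, v b + 1 := by
  rw [Finset.sum_update_of_mem (Finset.mem_univ j), ← Finset.add_sum_erase _ v (Finset.mem_univ j),
    Finset.sdiff_singleton_eq_erase]
  omega

theorem two_le_sum {v : Fin (q + 1) → ℕ} (hv : ∀ i, 2 ≤ v i) : 2 ≤ ∑ b, v b :=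
  (hv 0).trans (Finset.single_le_sum (fun _ _ => Nat.zero_le _) (Finset.mem_univ 0))

theorem coord_e_of_mem_homogeneous {f : M0 K n [⋀^Fin q]→ₗ[K] M0 K n}
    (hf : f ∈ homogeneous K n q (s : ℤ)) (v : Fin q → ℕ) {l : ℕ} (hl : l ≠ ∑ b, v b + s) :
    coord K n l (f fun b => e K n (v b)) = 0 := by
  induction hf using Submodule.span_induction with
  | mem f hf =>
    obtain ⟨k, I, -, -, -, hk, rfl⟩ := hf
    rw [tensor_apply, map_smul, toForm_mon]
    by_cases h : ∑ i ∈ I, i = ∑ b, v b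
    · rw [coord_e, if_neg (by omega), smul_zero]
    · rw [monForm_e_of_sum_ne h, zero_smul]
  | zero => simp
  | add f g _ _ hf hg => rw [AlternatingMap.add_apply, map_add, hf, hg, add_zero]
  | smul c f _ hf => rw [AlternatingMap.smul_apply, map_smul, hf, smul_zero]

/-- With at least two arguments, of which at most one is `e 1`, the index of the value is at least
`3`. One argument would not suffice: the identity map has degree `0`. -/
theorem coord_one_of_mem_homogeneous {f : M0 K n [⋀^Fin (q + 2)]→ₗ[K] M0 K n}
    (hf : f ∈ homogeneous K n (q + 2) (s : ℤ)) (x : Fin (q + 2) → M0 K n) :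
    coord K n 1 (f x) = 0 := by
  have := eq_zero_of_forall_e ((coord K n 1).compAlternatingMap f) (fun v hv => ?_) fun v hv => ?_
  · exact DFunLike.congr_fun this x
  · have : 2 ≤ ∑ b : Fin (q + 2), v b := two_le_sum hv
    exact coord_e_of_mem_homogeneous hf v (by omega)
  · have := two_le_sum hv
    rw [vecCons_e]
    refine coord_e_of_mem_homogeneous hf _ ?_
    rw [Fin.sum_univ_succ]
    simp only [Matrix.cons_val_zero, Matrix.cons_val_succ]
    omega

variable (K n) in
/-- The linear map with `e (i + 1) ↦ e i` for `2 ≤ i`, and `e 1, e 2 ↦ 0`. -/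
def shift : M0 K n →ₗ[K] M0 K n where
  toFun x := fun k => if 1 ≤ (k : ℕ) then coord K n (k + 2) x else 0
  map_add' x y := ext_entry fun k => by
    change (if 1 ≤ (k : ℕ) then _ else (0 : K)) = (if 1 ≤ (k : ℕ) then _ else 0) +
      if 1 ≤ (k : ℕ) then _ else 0
    split_ifs <;> simp
  map_smul' c x := ext_entry fun k => by
    change (if 1 ≤ (k : ℕ) then _ else (0 : K)) = c * if 1 ≤ (k : ℕ) then _ else 0
    split_ifs <;> simp

theorem coord_shift (i : ℕ) (x : M0 K n) :
    coord K n i (shift K n x) = if 2 ≤ i then coord K n (i + 1) x else 0 := by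
  by_cases h : 1 ≤ i ∧ i ≤ n
  · obtain ⟨i, rfl⟩ : ∃ k, i = k + 1 := ⟨i - 1, by omega⟩
    rw [coord, dif_pos h]
    change (if 1 ≤ i then coord K n (i + 2) x else 0) = _
    exact if_congr (by omega) rfl rfl
  · rw [coord_of_not h]
    split_ifs
    · rw [coord_of_not (by omega)]
    · rfl

variable [CharZero K]

/-- A cochain of nonnegative degree that vanishes on the span of `e 2, …, e n` is a
coboundary. -/
theorem mem_range_d_of_forall_coord (N : ℕ) (f : M0 K n [⋀^Fin (q + 2)]→ₗ[K] M0 K n)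
    (h₀ : ∀ v : Fin (q + 2) → ℕ, (∀ i, 2 ≤ v i) → f (fun b => e K n (v b)) = 0)
    (hs : ∀ v : Fin (q + 1) → ℕ, (∀ i, 2 ≤ v i) → ∀ l, l ≠ 1 + ∑ b, v b + s →
      coord K n l (f (Matrix.vecCons (e K n 1) fun b => e K n (v b))) = 0)
    (hN : ∀ v : Fin (q + 1) → ℕ, (∀ i, 2 ≤ v i) → ∀ l, N < l →
      coord K n l (f (Matrix.vecCons (e K n 1) fun b => e K n (v b))) = 0) :
    f ∈ LinearMap.range (d K (M0 K n) (M0 K n) (q + 1)) := by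
  induction N generalizing f with
  | zero =>
    have : f = 0 := eq_zero_of_forall_e f h₀
      fun v hv => ext_coord fun l hl _ => by rw [hN v hv l hl, map_zero]
    rw [this]
    exact Submodule.zero_mem _
  | succ N ih =>
    -- Since `shift` is a partial inverse of the action of `e 1`, subtracting `d g` cancels the
    -- values of `f` and leaves shifted values at raised arguments. The degree is kept and the
    -- highest possible coordinate drops by one.
    let g : M0 K n [⋀^Fin (q + 1)]→ₗ[K] M0 K n :=
      (shift K n).compAlternatingMap (f.curryLeft (e K n 1))
    have hg (x : Fin (q + 1) → M0 K n) : g x = shift K n (f (Matrix.vecCons (e K n 1) x)) := rfl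
    have hg₁ (x : Fin (q + 1) → M0 K n) : coord K n 1 (g x) = 0 := by
      rw [hg, coord_shift, if_neg (by omega)]
    have key (v : Fin (q + 1) → ℕ) (hv : ∀ i, 2 ≤ v i) :
        (f - d K (M0 K n) (M0 K n) (q + 1) g) (Matrix.vecCons (e K n 1) fun b => e K n (v b)) =
          ∑ j, shift K n (f (Matrix.vecCons (e K n 1) fun b =>
            e K n (Function.update v j (v j + 1) b))) := by
      -- The action of `e 1` undoes `shift` on coordinates `≥ 3`, and the others vanish because `1 +
      -- ∑ b, v b + s ≥ 3`.
      have hlie : ⁅e K n 1, g fun b => e K n (v b)⁆ =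
          f (Matrix.vecCons (e K n 1) fun b => e K n (v b)) := by
        refine ext_coord fun i hi hin => ?_
        rw [coord_lie_e_one, hg, coord_shift]
        have := two_le_sum hv
        split_ifs with h1 h2
        · rw [Nat.sub_add_cancel hi]
        · omega
        · exact (hs v hv i (by omega)).symm
      rw [AlternatingMap.sub_apply, d_apply_vecCons g hg₁ _ fun i => coord_one_e (hv i), hlie,
        sub_sub_cancel]
      exact Finset.sum_congr rfl fun j _ => by rw [update_lie_e hv, hg]
    have hf' := ih (f - d K (M0 K n) (M0 K n) (q + 1) g) (fun v hv => ?_) (fun v hv l hl => ?_)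
      fun v hv l hl => ?_
    · rw [← sub_add_cancel f (d K (M0 K n) (M0 K n) (q + 1) g)]
      exact Submodule.add_mem _ hf' (LinearMap.mem_range_self _ g)
    · rw [AlternatingMap.sub_apply, h₀ v hv,
        d_apply_eq_zero g hg₁ _ fun i => coord_one_e (hv i), sub_zero]
    · rw [key v hv, map_sum]
      refine Finset.sum_eq_zero fun j _ => ?_
      rw [coord_shift, hs _ (two_le_update hv j) _ (by rw [sum_update]; omega), ite_self]
    · rw [key v hv, map_sum]
      refine Finset.sum_eq_zero fun j _ => ?_
      rw [coord_shift, hN _ (two_le_update hv j) _ (by omega), ite_self]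

/-- A homogeneous cocycle of nonnegative degree is a coboundary if the last coordinates of its
values at basis vectors `e i` with `i ≥ 2` vanish. -/
theorem mem_coboundaries_of_coord {f : M0 K n [⋀^Fin (q + 2)]→ₗ[K] M0 K n}
    (hf : f ∈ homogeneous K n (q + 2) (s : ℤ))
    (hd : f ∈ cocycles K (M0 K n) (M0 K n) (q + 2))
    (h : ∀ v : Fin (q + 2) → ℕ, (∀ i, 2 ≤ v i) → coord K n n (f fun b => e K n (v b)) = 0) :
    f ∈ coboundaries K (M0 K n) (M0 K n) (q + 2) := by
  have h₁ := coord_one_of_mem_homogeneous hf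
  have hd' : d K (M0 K n) (M0 K n) (q + 2) f = 0 := hd
  -- Descending induction on the coordinate: in the cocycle condition, coordinate `n - k` expresses
  -- coordinate `n - k - 1` of a value through coordinates `n - k` at raised arguments.
  have hcoord (k : ℕ) : ∀ v : Fin (q + 2) → ℕ, (∀ i, 2 ≤ v i) →
      coord K n (n - k) (f fun b => e K n (v b)) = 0 := by
    induction k with
    | zero => exact h
    | succ k ih =>
      intro v hv
      by_cases hk : 3 ≤ n - k
      · have heq := d_apply_vecCons f h₁ (fun b => e K n (v b)) fun i => coord_one_e (hv i)
        rw [hd', AlternatingMap.zero_apply] at heq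
        have heq' := congrArg (coord K n (n - k)) heq.symm
        rw [map_sub, map_sum, map_zero, coord_lie_e_one, if_pos ⟨hk, by omega⟩,
          Finset.sum_eq_zero fun j _ => by rw [update_lie_e hv, ih _ (two_le_update hv j)],
          sub_zero] at heq'
        exact heq'
      · by_cases hk' : n - (k + 1) = 0
        · rw [hk', coord_of_not (by omega)]
        · refine coord_e_of_mem_homogeneous hf v ?_
          have h2 : 2 ≤ ∑ b : Fin (q + 1), v b.succ := two_le_sum fun i => hv i.succ
          have h3 := hv 0
          rw [Fin.sum_univ_succ]
          omega
  refine mem_range_d_of_forall_coord (s := s) n f (fun v hv => ?_) (fun v hv l hl => ?_)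
    fun v hv l hl => coord_of_not (by omega) _
  · refine ext_coord fun l hl hln => ?_
    have := hcoord (n - l) v hv
    rwa [Nat.sub_sub_self hln, ← map_zero (coord K n l)] at this
  · rw [vecCons_e]
    refine coord_e_of_mem_homogeneous hf _ ?_
    rw [Fin.sum_univ_succ]
    simpa using hl

end M0

/-! ## The last coordinates of a cohomology class -/

namespace M0

open LieCohomology ExtForm

/-- The sets of `q` numbers greater than `1` whose sum is at most `n`. -/
abbrev SumLE (q n : ℕ) : Type := {I : Finset ℕ // I.card = q ∧ (∀ i ∈ I, 2 ≤ i) ∧ ∑ i ∈ I, i ≤ n}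

theorem SumLE.le {q n : ℕ} (I : SumLE q n) {i : ℕ} (hi : i ∈ I.1) : i ≤ n :=
  (Finset.single_le_sum (f := fun i => i) (fun _ _ => Nat.zero_le _) hi).trans I.2.2.2

instance (q n : ℕ) : Finite (SumLE q n) :=
  Finite.of_injective (β := (Finset.range (n + 1)).powerset)
    (fun I => ⟨I.1, Finset.mem_powerset.2 fun _ hi =>
      Finset.mem_range.2 (Nat.lt_succ_of_le (I.le hi))⟩)
    fun _ _ h => Subtype.ext (Subtype.mk.inj h)

variable {K : Type*} [Field K] {n q s : ℕ}

variable (K n q) in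
/-- The coefficients of `e n ⊗ e^I` in a cochain, for the sets `I` of numbers greater than `1`
with sum at most `n`. -/
def lastCoord : (M0 K n [⋀^Fin q]→ₗ[K] M0 K n) →ₗ[K] (SumLE q n → K) where
  toFun f I := coord K n n (f fun b => e K n (I.1.orderEmbOfFin I.2.1 b))
  map_add' f g := by ext; simp
  map_smul' c f := by ext; simp

theorem lastCoord_apply (f : M0 K n [⋀^Fin q]→ₗ[K] M0 K n) (I : SumLE q n) :
    lastCoord K n q f I = coord K n n (f fun b => e K n (I.1.orderEmbOfFin I.2.1 b)) := rfl

theorem lastCoord_of_mem_homogeneous {f : M0 K n [⋀^Fin q]→ₗ[K] M0 K n}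
    (hf : f ∈ homogeneous K n q (s : ℤ)) {I : SumLE q n} (hI : ∑ i ∈ I.1, i + s ≠ n) :
    lastCoord K n q f I = 0 := by
  refine coord_e_of_mem_homogeneous hf _ fun h => hI ?_
  rw [sum_orderEmbOfFin I.2.1 fun i => i] at h
  exact h.symm

/-- Vanishing of `lastCoord` in terms of arbitrary sequences of basis vectors. -/
theorem coord_e_of_lastCoord_eq_zero {f : M0 K n [⋀^Fin q]→ₗ[K] M0 K n}
    (hf : f ∈ homogeneous K n q (s : ℤ)) (h : lastCoord K n q f = 0) (v : Fin q → ℕ)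
    (hv : ∀ i, 2 ≤ v i) : coord K n n (f fun b => e K n (v b)) = 0 := by
  -- Repeated indices give zero by alternation and a wrong sum gives zero by degree; otherwise `v`
  -- is a permuted enumeration of a set in `SumLE`.
  by_cases hinj : Function.Injective v
  · by_cases hsum : n = ∑ b, v b + s
    · have hI : (Finset.univ.image v).card = q := by
        rw [Finset.card_image_of_injective _ hinj, Finset.card_univ, Fintype.card_fin]
      let I : SumLE q n := ⟨Finset.univ.image v, hI, by simpa using hv, by
        rw [Finset.sum_image fun a _ b _ h => hinj h]
        omega⟩
      have hσ : ∀ b, ∃ c, I.1.orderEmbOfFin I.2.1 c = v b := fun b => by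
        have : v b ∈ (I.1 : Set ℕ) := by simp [I]
        rwa [← Finset.range_orderEmbOfFin I.1 I.2.1] at this
      choose σ hσ using hσ
      have hσinj : Function.Injective σ := fun a b hab => hinj (by rw [← hσ, ← hσ, hab])
      let τ : Equiv.Perm (Fin q) := Equiv.ofBijective σ (Finite.injective_iff_bijective.1 hσinj)
      have hcomp : (fun b => e K n (v b)) =
          (fun b => e K n (I.1.orderEmbOfFin I.2.1 b)) ∘ τ := by
        funext b
        rw [← hσ b]
        rfl
      have h0 := congrFun h I
      rw [lastCoord_apply, Pi.zero_apply] at h0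
      rw [hcomp, AlternatingMap.map_perm]
      rcases Int.units_eq_one_or (Equiv.Perm.sign τ) with h | h <;> simp [h, h0]
    · exact coord_e_of_mem_homogeneous hf v hsum
  · rw [AlternatingMap.map_eq_zero_of_not_injective f _ fun h => hinj fun a b hab => h (by
      simp only [hab]), map_zero]

variable [CharZero K]

/-- On `e 2, …, e n` the differential is a signed sum of brackets `⁅x i, g (…)⁆`. Such a bracket can
reach `e n` only if `x i` is `e (n - 1)`, and then another index `≥ 2` makes the sum exceed `n`. The
cochain `g` need not be homogeneous. -/
theorem lastCoord_of_mem_coboundaries {f : M0 K n [⋀^Fin (q + 2)]→ₗ[K] M0 K n}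
    (hf : f ∈ coboundaries K (M0 K n) (M0 K n) (q + 2)) : lastCoord K n (q + 2) f = 0 := by
  obtain ⟨g, rfl⟩ := hf
  funext I
  have hu : ∀ i, 2 ≤ I.1.orderEmbOfFin I.2.1 i := fun i =>
    I.2.2.1 _ (I.1.orderEmbOfFin_mem I.2.1 i)
  have hne (i : Fin (q + 2)) : n - 1 ≠ I.1.orderEmbOfFin I.2.1 i := by
    obtain ⟨j, hj⟩ := exists_ne i
    have h : ∑ b ∈ {i, j}, I.1.orderEmbOfFin I.2.1 b ≤ ∑ b, I.1.orderEmbOfFin I.2.1 b :=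
      Finset.sum_le_sum_of_subset (Finset.subset_univ _)
    rw [Finset.sum_pair hj.symm, sum_orderEmbOfFin I.2.1 fun i => i] at h
    have := I.2.2.2
    have := hu j
    omega
  rw [lastCoord_apply, d_apply_of_coord_one g _ fun i => coord_one_e (hu i), map_sum]
  refine Finset.sum_eq_zero fun i _ => ?_
  have hz : coord K n (n - 1) (e K n (I.1.orderEmbOfFin I.2.1 i)) = 0 := by
    rw [coord_e, if_neg fun h => hne i h.1]
  rw [map_zsmul, coord_lie, coord_one_e (hu i), hz]
  simp

variable (K n q) in
/-- The map `lastCoord` on cohomology classes. -/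
noncomputable def lastCoordH : HAd K n (q + 2) →ₗ[K] (SumLE (q + 2) n → K) :=
  Submodule.liftQ _ (lastCoord K n (q + 2) ∘ₗ Submodule.subtype _) fun _ hf =>
    lastCoord_of_mem_coboundaries hf

theorem mem_HDeg {μ : ℤ} {x : HAd K n q} : x ∈ HDeg K n q μ ↔
    ∃ f ∈ homogeneous K n q μ, ∃ hf, cls K (M0 K n) (M0 K n) q f hf = x := by
  constructor
  · rintro ⟨⟨f, hf⟩, h, rfl⟩
    exact ⟨f, h, hf, rfl⟩
  · rintro ⟨f, h, hf, rfl⟩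
    exact ⟨⟨f, hf⟩, h, rfl⟩

theorem lastCoordH_of_mem_HDeg {x : HAd K n (q + 2)} (hx : x ∈ HDeg K n (q + 2) (s : ℤ))
    {I : SumLE (q + 2) n} (hI : ∑ i ∈ I.1, i + s ≠ n) : lastCoordH K n q x I = 0 := by
  obtain ⟨f, h, hf, rfl⟩ := mem_HDeg.1 hx
  exact lastCoord_of_mem_homogeneous h hI

theorem eq_zero_of_mem_HDeg {x : HAd K n (q + 2)} (hx : x ∈ HDeg K n (q + 2) (s : ℤ))
    (h : lastCoordH K n q x = 0) : x = 0 := by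
  obtain ⟨f, hfs, hf, rfl⟩ := mem_HDeg.1 hx
  rw [cls, Submodule.Quotient.mk_eq_zero]
  exact mem_coboundaries_of_coord hfs hf (coord_e_of_lastCoord_eq_zero hfs h)

variable (K n q) in
-- The coordinates at sets of sum `n - s` see only degree `s`.
theorem iSupIndep_HDeg : iSupIndep fun s : ℕ => HDeg K n (q + 2) (s : ℤ) := by
  intro s
  rw [Submodule.disjoint_def]
  intro x hx hx'
  refine eq_zero_of_mem_HDeg hx (funext fun I => ?_)
  by_cases hI : ∑ i ∈ I.1, i + s = n
  · have : ⨆ (t : ℕ) (_ : t ≠ s), HDeg K n (q + 2) (t : ℤ) ≤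
        LinearMap.ker (LinearMap.proj I ∘ₗ lastCoordH K n q) :=
      iSup₂_le fun t ht y hy => lastCoordH_of_mem_HDeg hy (by omega)
    exact this hx'
  · exact lastCoordH_of_mem_HDeg hx hI

/-- Each homogeneous component has its own coordinates, so all of them have zero last coordinates.
-/
theorem eq_zero_of_mem_HPlus {x : HAd K n (q + 2)} (hx : x ∈ HPlus K n (q + 2))
    (h : lastCoordH K n q x = 0) : x = 0 := by
  obtain ⟨f, hf, rfl⟩ := (Submodule.mem_iSup_iff_exists_finsupp _ _).1 hx
  refine Finset.sum_eq_zero fun s hs => eq_zero_of_mem_HDeg (hf s) (funext fun I => ?_)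
  by_cases hI : ∑ i ∈ I.1, i + s = n
  · rw [← congrFun h I, Finsupp.sum, map_sum, Finset.sum_apply, Finset.sum_eq_single_of_mem s hs]
    exact fun t _ ht => lastCoordH_of_mem_HDeg (hf t) (by omega)
  · exact lastCoordH_of_mem_HDeg (hf s) hI

/-- If `s + m > n`, no set in `SumLE` has sum `n - s`, so classes of degree `s` have no last
coordinates. -/
theorem HPlus_eq_iSup (m : ℕ) (h : ∀ I : SumLE (q + 2) n, m ≤ ∑ i ∈ I.1, i) :
    HPlus K n (q + 2) = ⨆ (s : ℕ) (_ : s + m ≤ n), HDeg K n (q + 2) (s : ℤ) := by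
  refine le_antisymm (iSup_le fun s => ?_) (iSup₂_le fun s _ => le_iSup
    (fun s : ℕ => HDeg K n (q + 2) (s : ℤ)) s)
  by_cases hs : s + m ≤ n
  · exact le_iSup₂_of_le s hs le_rfl
  · intro x hx
    rw [eq_zero_of_mem_HDeg hx (funext fun I => lastCoordH_of_mem_HDeg hx (by
      have := h I
      omega))]
    exact Submodule.zero_mem _

end M0

/-! ### Unitriangular families and bases -/

/-- A family of vectors that is unitriangular with respect to the standard basis spans. -/
theorem span_range_eq_top_of_triangular {K ι : Type*} [Field K] [Fintype ι] [DecidableEq ι]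
    (c : ι → ι → K) (r : ι → ℕ) (h₁ : ∀ i, c i i = 1)
    (h : ∀ i j, j ≠ i → c i j ≠ 0 → r j < r i) : Submodule.span K (Set.range c) = ⊤ := by
  have key : ∀ (m : ℕ) (i : ι), r i < m → Pi.single i (1 : K) ∈ Submodule.span K (Set.range c) := by
    intro m
    induction m with
    | zero => intro i hi; omega
    | succ m ih =>
      intro i hi
      have hc : Pi.single i (1 : K) = c i - ∑ j ∈ Finset.univ.erase i, c i j • Pi.single j (1 : K) := by
        rw [eq_sub_iff_add_eq]
        conv_rhs => rw [pi_eq_sum_univ' (c i)]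
        rw [← Finset.add_sum_erase _ _ (Finset.mem_univ i), h₁, one_smul]
      rw [hc]
      refine Submodule.sub_mem _ (Submodule.subset_span ⟨i, rfl⟩)
        (Submodule.sum_mem _ fun j hj => ?_)
      by_cases hz : c i j = 0
      · rw [hz, zero_smul]
        exact Submodule.zero_mem _
      · exact Submodule.smul_mem _ _ (ih j (by
          have := h i j (Finset.ne_of_mem_erase hj) hz
          omega))
  rw [← top_le_iff, ← (Pi.basisFun K ι).span_eq, Submodule.span_le]
  rintro _ ⟨i, rfl⟩
  rw [Pi.basisFun_apply]
  exact key _ i (Nat.lt_succ_self _)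

namespace M0

variable {K : Type*} [Field K] [CharZero K] {n q : ℕ}

open LieCohomology

/-- A family of classes in `H^q_+` whose last coordinates are unitriangular is a basis. -/
theorem exists_basis_HPlus {ι : Type*} (τ : ι ≃ SumLE (q + 2) n) (b : ι → HPlus K n (q + 2))
    (h₁ : ∀ p, lastCoordH K n q (b p) (τ p) = 1)
    (h : ∀ p J, J ≠ τ p → lastCoordH K n q (b p) J ≠ 0 → (τ p).1.sup id < J.1.sup id) :
    ∃ B : Module.Basis ι K (HPlus K n (q + 2)), ∀ p, B p = b p := by
  classical
  have : Finite ι := Finite.of_equiv _ τ.symm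
  have := Fintype.ofFinite ι
  let F : HPlus K n (q + 2) →ₗ[K] (ι → K) :=
    LinearMap.funLeft K K τ ∘ₗ lastCoordH K n q ∘ₗ Submodule.subtype _
  have hF : Function.Injective F := by
    rw [← LinearMap.ker_eq_bot, LinearMap.ker_eq_bot']
    intro x hx
    refine Subtype.ext (eq_zero_of_mem_HPlus x.2 (funext fun I => ?_))
    have := congrFun hx (τ.symm I)
    simpa [F, LinearMap.funLeft_apply] using this
  have hspan : Submodule.span K (Set.range (F ∘ b)) = ⊤ := by
    -- The other monomials have a larger greatest index; subtracting it from `n` gives a rank that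
    -- decreases.
    refine span_range_eq_top_of_triangular (F ∘ b) (fun p => n - (τ p).1.sup id) h₁
      fun p p' hp hne => ?_
    have := h p (τ p') (fun h => hp (τ.injective h)) hne
    have hle : (τ p').1.sup id ≤ n := Finset.sup_le fun i hi => (τ p').le hi
    change n - (τ p').1.sup id < n - (τ p).1.sup id
    omega
  have hli : LinearIndependent K b := by
    refine LinearIndependent.of_comp F
      (linearIndependent_of_top_le_span_of_card_eq_finrank hspan.ge ?_)
    rw [Module.finrank_fintype_fun_eq_card]
  refine ⟨Module.Basis.mk hli fun x _ => ?_, fun p => Module.Basis.mk_apply _ _ _⟩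
  have hx : F x ∈ Submodule.span K (Set.range (F ∘ b)) := hspan ▸ Submodule.mem_top
  rw [Set.range_comp, Submodule.span_image] at hx
  obtain ⟨y, hy, hyx⟩ := hx
  rwa [← hF hyx]

end M0

/-! ## The cocycles `Ψ` -/

namespace M0

open LieCohomology ExtForm

variable {K : Type*} [Field K] {n q s : ℕ}

variable (K n q) in
/-- The cochain `∑ k, e_{w + s + k} ⊗ D₋₁^k ω(e^J ∧ e^{j+1})` for a set `J` with largest element
`j`, where `w` is the sum of the elements of `J` and `j + 1`. -/
noncomputable def genPsi (J : Finset ℕ) (j s : ℕ) : M0 K n [⋀^Fin q]→ₗ[K] M0 K n :=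
  ∑ k ∈ Finset.range (n + 1 - (∑ i ∈ J, i + (j + 1) + s)),
    tensor K n q (∑ i ∈ J, i + (j + 1) + s + k) ((Dneg ^ k) (altSum K J (j + 1)))

theorem Psi2_eq_genPsi (j s : ℕ) : Psi2 K n j s = genPsi K n 2 {j} j s := by
  rw [Psi2, genPsi, Finset.sum_singleton, show j + (j + 1) + s = 2 * j + 1 + s by omega]
  rfl

theorem Psi3_eq_genPsi {i j : ℕ} (hij : i < j) (s : ℕ) :
    Psi3 K n i j s = genPsi K n 3 {i, j} j s := by
  rw [Psi3, genPsi, Finset.sum_pair hij.ne,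
    show i + j + (j + 1) + s = i + 2 * j + 1 + s by omega]
  rfl

theorem tensor_mem_homogeneous {w l : ℕ} {ξ : ExtForm K}
    (hξ : ξ ∈ Finsupp.supported K K (weightSets q w)) (hl : w + s = l) (hl₁ : 1 ≤ l) (hn : l ≤ n) :
    tensor K n q l ξ ∈ homogeneous K n q (s : ℤ) := by
  let T : ExtForm K →ₗ[K] M0 K n [⋀^Fin q]→ₗ[K] M0 K n :=
    { toFun := tensor K n q l
      map_add' := fun x y => by
        ext1 v
        simp [tensor_apply, add_smul]
      map_smul' := fun c x => by
        ext1 v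
        simp [tensor_apply, mul_smul] }
  refine map_mem_of_mon hξ T _ fun I hI => Submodule.subset_span
    ⟨l, I, Finset.mem_Icc.2 ⟨hl₁, hn⟩, fun i hi => ?_, hI.1, ?_, rfl⟩
  · have := le_of_mem_weightSets hI hi
    exact Finset.mem_Icc.2 ⟨by omega, by omega⟩
  · rw [hI.2.2, ← hl]
    push_cast
    rfl

section genPsi

variable {J : Finset ℕ} {j : ℕ} (hq : J.card = q + 1) (hj : j ∈ J) (hJ : ∀ i ∈ J, 2 ≤ i ∧ i ≤ j)
include hq hj hJ

theorem Dneg_pow_altSum_mem (k : ℕ) : (Dneg ^ k) (altSum K J (j + 1)) ∈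
    Finsupp.supported K K (weightSets (q + 2) (∑ i ∈ J, i + (j + 1) + k)) := by
  rw [show q + 2 = J.card + 1 by omega]
  exact Dneg_pow_mem (altSum_mem (by have := hJ j hj; omega) fun i hi =>
    ⟨(hJ i hi).1, Nat.lt_succ_of_le (hJ i hi).2⟩) k

theorem genPsi_mem_homogeneous : genPsi K n (q + 2) J j s ∈ homogeneous K n (q + 2) (s : ℤ) := by
  refine Submodule.sum_mem _ fun k hk => ?_
  rw [Finset.mem_range] at hk
  exact tensor_mem_homogeneous (Dneg_pow_altSum_mem hq hj hJ k) (by omega) (by omega) (by omega)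

/-- The coefficients satisfy `D₁ ξ_{k+1} = ξ_k` and `D₁ ξ_0 = 0`, so both sides of the cocycle
identity agree after an index shift. -/
theorem genPsi_mem_cocycles [CharZero K] :
    genPsi K n (q + 2) J j s ∈ cocycles K (M0 K n) (M0 K n) (q + 2) := by
  have h₁ := coord_one_of_mem_homogeneous (K := K) (n := n) (s := s)
    (genPsi_mem_homogeneous hq hj hJ)
  change d K (M0 K n) (M0 K n) (q + 2) (genPsi K n (q + 2) J j s) = 0
  refine eq_zero_of_forall_coord _ (fun x hx => d_apply_eq_zero _ h₁ x hx) fun x hx => ?_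
  rw [d_apply_vecCons _ h₁ x hx, sub_eq_zero]
  set N := ∑ i ∈ J, i + (j + 1) + s with hN
  have hj2 := (hJ j hj).1
  by_cases hnN : N ≤ n
  · obtain ⟨m, hm⟩ : ∃ m, n + 1 - N = m + 1 := ⟨n - N, by omega⟩
    -- Here `D₁` leaves `e^J ∧ e^j`, which vanishes since `j ∈ J`.
    have hD₀ : D₁ ((Dneg ^ 0) (altSum K J (j + 1))) = 0 := by
      rw [pow_zero, Module.End.one_apply,
        D₁_altSum hj2 fun i hi => ⟨(hJ i hi).1, Nat.lt_succ_of_le (hJ i hi).2⟩,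
        wedge_mon_of_mem hj]
    have hD (k : ℕ) : D₁ ((Dneg ^ (k + 1)) (altSum K J (j + 1))) =
        (Dneg ^ k) (altSum K J (j + 1)) := by
      rw [pow_succ', Module.End.mul_apply]
      exact D₁_Dneg (Dneg_pow_altSum_mem hq hj hJ k)
    have hterm (k : ℕ) (hk : k ≤ m) :
        ∑ b, tensor K n (q + 2) (N + k) ((Dneg ^ k) (altSum K J (j + 1)))
          (Function.update x b ⁅e K n 1, x b⁆) =
        toForm K n (q + 2) (D₁ ((Dneg ^ k) (altSum K J (j + 1)))) x • e K n (N + k) := by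
      simp only [tensor_apply]
      rw [← Finset.sum_smul, toForm_D₁ _ (Dneg_pow_altSum_mem hq hj hJ k)]
      omega
    -- Since `N + m = n`, the action of `e 1` kills the last summand.
    have hlast : e K n (N + m + 1) = 0 := by
      refine ext_coord fun i _ hi => ?_
      rw [coord_e, if_neg (by omega), map_zero]
    simp only [genPsi, sum_apply, ← hN, hm]
    rw [Finset.sum_comm, Finset.sum_congr rfl fun k hk => hterm k (by
        rw [Finset.mem_range] at hk
        omega), Finset.sum_range_succ'
          (fun k => toForm K n (q + 2) (D₁ ((Dneg ^ k) (altSum K J (j + 1)))) x • e K n (N + k)) m,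
      hD₀, map_zero, AlternatingMap.zero_apply, zero_smul, add_zero,
      lie_sum, Finset.sum_range_succ, tensor_apply, lie_smul, lie_e_one_e (by omega), hlast,
      smul_zero, add_zero]
    refine Finset.sum_congr rfl fun k _ => ?_
    rw [tensor_apply, lie_smul, lie_e_one_e (by omega), hD, add_assoc]
  · have h0 : genPsi K n (q + 2) J j s = 0 := by
      rw [genPsi, ← hN, Nat.sub_eq_zero_of_le (by omega), Finset.sum_range_zero]
    simp [h0]

/-- Only the summand numbered `k` has values along `e n`. -/
theorem lastCoord_genPsi {k : ℕ} (hk : ∑ i ∈ J, i + (j + 1) + s + k = n) (I : SumLE (q + 2) n) :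
    lastCoord K n (q + 2) (genPsi K n (q + 2) J j s) I =
      ((Dneg ^ k) (altSum K J (j + 1))) I.1 := by
  rw [lastCoord_apply, genPsi, sum_apply, map_sum, Finset.sum_eq_single_of_mem k
    (Finset.mem_range.2 (by omega)), tensor_apply, map_smul, coord_e, if_pos (by omega),
    toForm_e _ (Dneg_pow_altSum_mem hq hj hJ k), smul_eq_mul, mul_one]
  · omega
  · intro l _ hl
    rw [tensor_apply, map_smul, coord_e, if_neg (by omega), smul_zero]

end genPsi

end M0
-- Leading monomials of the cocycles
namespace M0

open LieCohomology ExtForm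

variable {K : Type*} [Field K] [CharZero K] {n q s : ℕ}

/-- Classes of cochains `genPsi` form a basis if their leading monomials run through the sets
of numbers greater than `1` with sum at most `n`. -/
theorem exists_basis_genPsi {r : ℕ} (hr : 2 ≤ r) {ι : Type*} (J : ι → Finset ℕ) (j s k : ι → ℕ)
    (hq : ∀ p, (J p).card + 1 = r) (hj : ∀ p, j p ∈ J p) (hJ : ∀ p, ∀ i ∈ J p, 2 ≤ i ∧ i ≤ j p)
    (hk : ∀ p, ∑ i ∈ J p, i + (j p + 1) + s p + k p = n)
    (hinj : Function.Injective fun p => insert (j p + 1 + k p) (J p))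
    (hsurj : ∀ I : SumLE r n, ∃ p, insert (j p + 1 + k p) (J p) = I.1) :
    ∃ B : Module.Basis ι K (HPlus K n r), ∀ p,
      ∃ h : genPsi K n r (J p) (j p) (s p) ∈ cocycles K (M0 K n) (M0 K n) r,
        (B p : HAd K n r) =
          cls K (M0 K n) (M0 K n) r (genPsi K n r (J p) (j p) (s p)) h := by
  obtain ⟨q, rfl⟩ : ∃ q, r = q + 2 := ⟨r - 2, by omega⟩
  replace hq (p : ι) : (J p).card = q + 1 := Nat.succ_injective (hq p)
  have hn (p : ι) : j p + 1 + k p ∉ J p := fun h => by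
    have := (hJ p _ h).2
    omega
  have hlead (p : ι) : (insert (j p + 1 + k p) (J p)).sup id = j p + 1 + k p := by
    rw [Finset.sup_insert, id, sup_eq_left]
    refine Finset.sup_le fun i hi => ?_
    have := (hJ p i hi).2
    simp only [id]
    omega
  let t (p : ι) : SumLE (q + 2) n := ⟨insert (j p + 1 + k p) (J p), by
      rw [Finset.card_insert_of_notMem (hn p), hq], fun i hi => by
      rcases Finset.mem_insert.1 hi with rfl | hi
      · have := (hJ p _ (hj p)).1
        omega
      · exact (hJ p i hi).1, by
      rw [Finset.sum_insert (hn p)]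
      have := hk p
      omega⟩
  have ht : Function.Bijective t :=
    ⟨fun p p' h => hinj (congrArg Subtype.val h), fun I => (hsurj I).imp fun p h => Subtype.ext h⟩
  have hc (p : ι) : genPsi K n (q + 2) (J p) (j p) (s p) ∈
      cocycles K (M0 K n) (M0 K n) (q + 2) := genPsi_mem_cocycles (hq p) (hj p) (hJ p)
  let b (p : ι) : HPlus K n (q + 2) := ⟨cls K (M0 K n) (M0 K n) (q + 2) _ (hc p),
    Submodule.mem_iSup_of_mem (s p)
      (mem_HDeg.2 ⟨_, genPsi_mem_homogeneous (hq p) (hj p) (hJ p), hc p, rfl⟩)⟩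
  have hb (p : ι) (I : SumLE (q + 2) n) : lastCoordH K n q (b p) I =
      (Dneg ^ k p) (altSum K (J p) (j p + 1)) I.1 :=
    lastCoord_genPsi (hq p) (hj p) (hJ p) (hk p) I
  have hsub (p : ι) := Dneg_pow_altSum_sub_mem (K := K) (J := J p) (m := j p + 1)
    (by have := (hJ p _ (hj p)).1; omega)
    (fun i hi => ⟨(hJ p i hi).1, Nat.lt_succ_of_le (hJ p i hi).2⟩) (k p)
  -- At sets with no element above the leading index only the leading monomial counts.
  have hsub' (p : ι) (I : Finset ℕ) (hI : ∀ i ∈ I, i ≤ j p + 1 + k p) :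
      (Dneg ^ k p) (altSum K (J p) (j p + 1)) I = mon K (insert (j p + 1 + k p) (J p)) I := by
    have := (Finsupp.mem_supported' K _).1 (hsub p) I (by
      rintro ⟨i, hi, h⟩
      have := hI i hi
      omega)
    rwa [Finsupp.sub_apply, sub_eq_zero] at this
  have hone (p : ι) : lastCoordH K n q (b p) (t p) = 1 := by
    rw [hb, hsub' p]
    · exact Finsupp.single_eq_same
    · exact fun i hi => (Finset.le_sup (f := id) hi).trans (hlead p).le
  have hzero (p : ι) (I : SumLE (q + 2) n) (hI : I ≠ t p) (hne : lastCoordH K n q (b p) I ≠ 0) :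
      (t p).1.sup id < I.1.sup id := by
    by_contra hlt
    refine hne ?_
    rw [hb, hsub' p]
    · exact Finsupp.single_eq_of_ne fun h => hI (Subtype.ext h)
    · exact fun i hi => ((Finset.le_sup (f := id) hi).trans (not_lt.1 hlt)).trans (hlead p).le
  obtain ⟨B, hB⟩ := exists_basis_HPlus (Equiv.ofBijective t ht) b hone hzero
  exact ⟨B, fun p => ⟨hc p, by rw [hB]⟩⟩

theorem SumLE.exists_pair (I : SumLE 2 n) : ∃ a b, 2 ≤ a ∧ a < b ∧ I.1 = insert b {a} ∧
    a + b ≤ n := by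
  obtain ⟨I, hI⟩ := I
  obtain ⟨J, b, rfl, hJ, -, hJ1, hsum⟩ := exists_insert_of_mem_weightSets (q := 1)
    (w := ∑ i ∈ I, i) ⟨hI.1, hI.2.1, rfl⟩
  obtain ⟨a, rfl⟩ := Finset.card_eq_one.1 hJ1
  have ha := hJ a (Finset.mem_singleton_self a)
  rw [Finset.sum_singleton] at hsum
  exact ⟨a, b, ha.1, ha.2, rfl, by have := hI.2.2; omega⟩

theorem SumLE.exists_triple (I : SumLE 3 n) : ∃ a b c, 2 ≤ a ∧ a < b ∧ b < c ∧
    I.1 = insert c {a, b} ∧ a + b + c ≤ n := by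
  obtain ⟨I, hI⟩ := I
  obtain ⟨J, c, rfl, hJ, -, hJ2, hsum⟩ := exists_insert_of_mem_weightSets (q := 2)
    (w := ∑ i ∈ I, i) ⟨hI.1, hI.2.1, rfl⟩
  have hle := hI.2.2
  obtain ⟨a, b, ha, hab, hJ', hle'⟩ := SumLE.exists_pair (n := ∑ i ∈ J, i)
    ⟨J, hJ2, fun i hi => (hJ i hi).1, le_rfl⟩
  simp only at hJ'
  subst hJ'
  have hb := hJ b (by simp)
  exact ⟨a, b, c, ha, hab, hb.2, by rw [Finset.pair_comm a b], by omega⟩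

end M0

/-! ### The cohomology in degrees two and three -/

theorem mainTheorem3 (K : Type*) [Field K] [CharZero K] (n : ℕ) :
    -- `H^2_+` is the direct sum of the `H^2_s` with `0 ≤ s ≤ n - 5`
    (iSupIndep (fun s : ℕ => M0.HDeg K n 2 (s : ℤ)) ∧
      M0.HPlus K n 2 = ⨆ (s : ℕ) (_ : s + 5 ≤ n), M0.HDeg K n 2 (s : ℤ)) ∧
    -- the `Ψ_{j,s}` are homogeneous cocycles of degree `s`
    (∀ j s : ℕ, 2 ≤ j → 2 * j + 1 + s ≤ n →
      M0.Psi2 K n j s ∈ LieCohomology.cocycles K (M0 K n) (M0 K n) 2 ∧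
      M0.Psi2 K n j s ∈ M0.homogeneous K n 2 (s : ℤ)) ∧
    -- their classes form a basis of `H^2_+`
    (∃ b : Module.Basis {p : ℕ × ℕ // 2 ≤ p.1 ∧ 2 * p.1 + 1 + p.2 ≤ n} K (M0.HPlus K n 2),
      ∀ p : {p : ℕ × ℕ // 2 ≤ p.1 ∧ 2 * p.1 + 1 + p.2 ≤ n},
        ∃ h : M0.Psi2 K n p.1.1 p.1.2 ∈ LieCohomology.cocycles K (M0 K n) (M0 K n) 2,
        (b p : M0.HAd K n 2) = LieCohomology.cls K (M0 K n) (M0 K n) 2 (M0.Psi2 K n p.1.1 p.1.2) h) ∧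
    -- `H^3_+` is the direct sum of the `H^3_s` with `0 ≤ s ≤ n - 9`
    (iSupIndep (fun s : ℕ => M0.HDeg K n 3 (s : ℤ)) ∧
      M0.HPlus K n 3 = ⨆ (s : ℕ) (_ : s + 9 ≤ n), M0.HDeg K n 3 (s : ℤ)) ∧
    -- the `Ψ_{i,j,s}` are homogeneous cocycles of degree `s`
    (∀ i j s : ℕ, 2 ≤ i → i < j → i + 2 * j + 1 + s ≤ n →
      M0.Psi3 K n i j s ∈ LieCohomology.cocycles K (M0 K n) (M0 K n) 3 ∧
      M0.Psi3 K n i j s ∈ M0.homogeneous K n 3 (s : ℤ)) ∧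
    -- their classes form a basis of `H^3_+`
    (∃ b : Module.Basis {p : ℕ × ℕ × ℕ // 2 ≤ p.1 ∧ p.1 < p.2.1 ∧
        p.1 + 2 * p.2.1 + 1 + p.2.2 ≤ n} K (M0.HPlus K n 3),
      ∀ p : {p : ℕ × ℕ × ℕ // 2 ≤ p.1 ∧ p.1 < p.2.1 ∧
        p.1 + 2 * p.2.1 + 1 + p.2.2 ≤ n}, ∃ h : M0.Psi3 K n p.1.1 p.1.2.1 p.1.2.2 ∈
          LieCohomology.cocycles K (M0 K n) (M0 K n) 3,
        (b p : M0.HAd K n 3) = LieCohomology.cls K (M0 K n) (M0 K n) 3 (M0.Psi3 K n p.1.1 p.1.2.1 p.1.2.2) h) := by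
  refine ⟨⟨M0.iSupIndep_HDeg K n 0, M0.HPlus_eq_iSup 5 fun I => ?_⟩, fun j s hj _ => ?_, ?_,
    ⟨M0.iSupIndep_HDeg K n 1, M0.HPlus_eq_iSup 9 fun I => ?_⟩, fun i j s hi hij _ => ?_, ?_⟩
  · obtain ⟨a, b, ha, hab, h, -⟩ := I.exists_pair
    rw [h, Finset.sum_pair hab.ne']
    omega
  · rw [M0.Psi2_eq_genPsi]
    have hJ : ∀ i ∈ ({j} : Finset ℕ), 2 ≤ i ∧ i ≤ j := by
      simpa using hj
    exact ⟨M0.genPsi_mem_cocycles (q := 0) (Finset.card_singleton j)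
        (Finset.mem_singleton_self j) hJ,
      M0.genPsi_mem_homogeneous (q := 0) (Finset.card_singleton j)
        (Finset.mem_singleton_self j) hJ⟩
  · simp only [M0.Psi2_eq_genPsi]
    refine M0.exists_basis_genPsi le_rfl
      (ι := {p : ℕ × ℕ // 2 ≤ p.1 ∧ 2 * p.1 + 1 + p.2 ≤ n}) (fun p => {p.1.1}) (fun p => p.1.1) (fun p => p.1.2)
      (fun p => n - (2 * p.1.1 + 1 + p.1.2)) (fun p => by rw [Finset.card_singleton])
      (fun p => Finset.mem_singleton_self _) (fun p => by simpa using p.2.1) (fun p => ?_) ?_ ?_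
    · have := p.2.2
      rw [Finset.sum_singleton]
      omega
    · rintro ⟨⟨j, s⟩, hj, hs⟩ ⟨⟨j', s'⟩, hj', hs'⟩ h
      simp only [Finset.ext_iff, Finset.mem_insert, Finset.mem_singleton] at h hj hs hj' hs'
      -- Comparing membership at these elements is enough for linear arithmetic to recover `j` and
      -- `s`.
      have h1 := h j
      have h2 := h (j + 1 + (n - (2 * j + 1 + s)))
      have h3 := h j'
      simp only [Subtype.mk.injEq, Prod.mk.injEq]
      omega
    · intro I
      obtain ⟨a, b, ha, hab, h, hn⟩ := I.exists_pair
      -- The monomial `e^a ∧ e^b` leads for `j = a` and `k = b - a - 1`; the degree `s` is then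
      -- forced by the weight.
      refine ⟨⟨(a, n - (a + b)), ha, ?_⟩, ?_⟩
      · simp only
        omega
      · rw [h]
        simp only
        congr 1
        omega
  · obtain ⟨a, b, c, ha, hab, hbc, h, -⟩ := I.exists_triple
    rw [h, Finset.sum_insert (by simp only [Finset.mem_insert, Finset.mem_singleton]; omega),
      Finset.sum_pair hab.ne]
    omega
  · rw [M0.Psi3_eq_genPsi hij]
    have hJ : ∀ a ∈ ({i, j} : Finset ℕ), 2 ≤ a ∧ a ≤ j := by
      intro a ha
      simp only [Finset.mem_insert, Finset.mem_singleton] at ha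
      omega
    have hj : j ∈ ({i, j} : Finset ℕ) := by simp
    exact ⟨M0.genPsi_mem_cocycles (q := 1) (Finset.card_pair hij.ne) hj hJ,
      M0.genPsi_mem_homogeneous (q := 1) (Finset.card_pair hij.ne) hj hJ⟩
  · have hPsi (p : {p : ℕ × ℕ × ℕ // 2 ≤ p.1 ∧ p.1 < p.2.1 ∧ p.1 + 2 * p.2.1 + 1 + p.2.2 ≤ n}) :
        M0.Psi3 K n p.1.1 p.1.2.1 p.1.2.2 =
          M0.genPsi K n 3 {p.1.1, p.1.2.1} p.1.2.1 p.1.2.2 := M0.Psi3_eq_genPsi p.2.2.1 _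
    simp only [hPsi]
    refine M0.exists_basis_genPsi (by omega)
      (ι := {p : ℕ × ℕ × ℕ // 2 ≤ p.1 ∧ p.1 < p.2.1 ∧ p.1 + 2 * p.2.1 + 1 + p.2.2 ≤ n}) (fun p => {p.1.1, p.1.2.1}) (fun p => p.1.2.1)
      (fun p => p.1.2.2) (fun p => n - (p.1.1 + 2 * p.1.2.1 + 1 + p.1.2.2))
      (fun p => by rw [Finset.card_pair p.2.2.1.ne]) (fun p => by simp) (fun p a ha => ?_) (fun p => ?_)
      ?_ ?_
    · obtain ⟨h1, h2, -⟩ := p.2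
      simp only [Finset.mem_insert, Finset.mem_singleton] at ha
      omega
    · obtain ⟨h1, h2, h3⟩ := p.2
      rw [Finset.sum_pair h2.ne]
      omega
    · rintro ⟨⟨i, j, s⟩, hi, hij, hs⟩ ⟨⟨i', j', s'⟩, hi', hij', hs'⟩ h
      simp only [Finset.ext_iff, Finset.mem_insert, Finset.mem_singleton] at h hi hij hs hi' hij' hs'
      have h1 := h i
      have h2 := h j
      have h3 := h (j + 1 + (n - (i + 2 * j + 1 + s)))
      have h4 := h i'
      have h5 := h j'
      simp only [Subtype.mk.injEq, Prod.mk.injEq]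
      omega
    · intro I
      obtain ⟨a, b, c, ha, hab, hbc, h, hn⟩ := I.exists_triple
      -- The two smaller indices give `i` and `j`, and the largest gives `k = c - b - 1`.
      refine ⟨⟨(a, b, n - (a + b + c)), ha, hab, ?_⟩, ?_⟩
      · simp only
        omega
      · rw [h]
        simp only
        congr 1
        omega
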